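/- All graphs are finite and simple, and $\rho(G)$ denotes the largest eigenvalue of the adjacency matrix of $G$. A graph is $F$-free if it contains no (not necessarily induced) subgraph isomorphic to $F$. Let $\mathrm{spex}(n,F)$ be the maximum of $\rho(G)$ over all $F$-free graphs $G$ of order $n$, and let $\mathrm{SPEX}(n,F)$ be the set of $F$-free graphs $G$ of order $n$ with $\rho(G)=\mathrm{spex}(n,F)$, considered up to isomorphism. For $n>k>0$ and $0\le p\le\lfloor (n-k)/2\rfloor$, let $S_{n,k}^{p}$ be the graph obtained from the join of the complete graph $K_k$ with $n-k$ isolated vertices by adding $p$ pairwise disjoint edges among these $n-k$ vertices. A spider is a tree of order at least $4$ with at most one vertex of degree at least $3$. Its center is the vertex of degree at least $3$; if there is none, the spider is a path and any vertex of degree $2$ may be taken as its center. A leg is a path from the center to a leaf, and its length is its number of edges. Theorem. Let $r_1,r_2,r_3,r,s,\ell$ be non-negative integers with $r=r_1+r_2+r_3$ and $\ell\ge 4$, and let $F$ be a spider of order $\ell$ which, with respect to a chosen center, has $r_1$ legs of odd length at least $5$, $r_2$ legs of length $3$, $r_3$ legs of length $1$ and $s$ legs of even length. Then, for all sufficiently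 large $n$ (depending on $F$), $$\mathrm{SPEX}(n,F)=\begin{cases} \{S_{n,(\ell-r-1)/2}^{0}\} & \text{if } s\ge 1 \text{ and } r\ge 1,\\ \{S_{n,(\ell-3)/2}^{1}\} & \text{if } s\ge 1 \text{ and } r=0,\\ \{S_{n,(\ell-r-1)/2}^{1}\} & \text{if } s=0 \text{ and } r_1\ge 1,\\ \{S_{n,(\ell-r-1)/2}^{r-1}\} & \text{if } s=0,\ r_1=0,\ r_2\ge 1 \text{ and } r_3\in\{0,1\},\\ \{S_{n,(\ell-r-1)/2}^{\lfloor (2n-\ell+r+1)/4\rfloor}\} & \text{if } s=0,\ r_1=0,\ r_2\ge 1 \text{ and } r_3\ge 2. \end{cases}$$ (The remaining case $s=r_1=r_2=0$, in which $F$ is a star, is not covered.) -/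

import Mathlib

namespace SpectralSpider

/-- The spectral radius `ρ(G)` of a finite graph: the largest eigenvalue of its adjacency matrix.
The spectrum is a finite set, nonempty as soon as `G` has a vertex, so the supremum is a maximum. -/
noncomputable def specRadius {V : Type*} [Fintype V] (G : SimpleGraph V) : ℝ :=
  open Classical in sSup (spectrum ℝ (G.adjMatrix ℝ))

/-- `spex(n, F)`: the maximum spectral radius of an `F`-free graph of order `n`
(a supremum over a finite set of reals). -/
noncomputable def spex {V : Type*} (n : ℕ) (F : SimpleGraph V) : ℝ :=
  sSup {x : ℝ | ∃ G : SimpleGraph (Fin n), F.Free G ∧ specRadius G = x}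

/-- `SPEX(n, F)`: the (labelled) `F`-free graphs of order `n` whose spectral radius is
`spex(n, F)`. -/
def SPEX {V : Type*} (n : ℕ) (F : SimpleGraph V) : Set (SimpleGraph (Fin n)) :=
  {G | F.Free G ∧ specRadius G = spex n F}

/-- The graph `S_{n,k}^p`: the vertices `0, …, k-1` are adjacent to all other vertices, and among
the remaining `n - k` vertices the only edges are the `p` independent edges
`{k + 2i, k + 2i + 1}`, `i < p` (meant for `0 < k < n` and `p ≤ ⌊(n - k) / 2⌋`). -/
def graphS (n k p : ℕ) : SimpleGraph (Fin n) :=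
  SimpleGraph.fromRel fun u v : Fin n =>
    (u : ℕ) < k ∨ ∃ i < p, (u : ℕ) = k + 2 * i ∧ (v : ℕ) = k + 2 * i + 1

/-- The set `{S_{n,k}^p}`, graphs being considered up to isomorphism. -/
def isoClassS (n k p : ℕ) : Set (SimpleGraph (Fin n)) :=
  {G | Nonempty (G ≃g graphS n k p)}

/-- A spider: a tree of order at least 4 with at most one vertex of degree at least 3. -/
def IsSpider {V : Type*} [Fintype V] (F : SimpleGraph V) [DecidableRel F.Adj] : Prop :=
  F.IsTree ∧ 4 ≤ Fintype.card V ∧ {v : V | 3 ≤ F.degree v}.Subsingleton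

/-- `c` is a center of the spider `F`: the vertex of degree at least 3 or, if all degrees are at
most 2 (so that `F` is a path), any vertex of degree 2. -/
def IsCenter {V : Type*} [Fintype V] (F : SimpleGraph V) [DecidableRel F.Adj] (c : V) : Prop :=
  3 ≤ F.degree c ∨ (F.degree c = 2 ∧ ∀ v, F.degree v ≤ 2)

/-- The number of legs of `F` with center `c` whose length satisfies `P`. A leg is a path from `c`
to a leaf; in a tree such a path is determined by the leaf, so the leaves are counted. -/
noncomputable def legCount {V : Type*} [Fintype V] (F : SimpleGraph V) [DecidableRel F.Adj]
    (c : V) (P : ℕ → Prop) : ℕ :=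
  {v : V | F.degree v = 1 ∧ ∃ p : F.Walk c v, p.IsPath ∧ P p.length}.ncard

end SpectralSpider

/-!
Let `x ≥ 0` be an eigenvector for the spectral radius `ρ` of an extremal graph, with maximum entry
`1`. A graph without a copy of the tree `F` is sparse, and if deleting an independent set of
`k + 1` vertices from `F` leaves no edges, it contains no complete bipartite graph `K_{k+1,|F|}`
either. Counting walks of length two from a vertex `v`, and using `ρ ^ 2 ≥ k (n - k)`, shows that
exactly `k` vertices have entry close to `1`, and that they are adjacent to almost all vertices.
Any vertex that misses one of them could be disconnected and rejoined to all of them, which would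
raise `ρ` without creating a copy of `F`; so these `k` vertices are adjacent to all others.

What remains is the graph induced on the other `n - k` vertices. The tree `F` embeds as soon as
this graph contains what is left of `F` after deleting some independent set of at most `k`
vertices. For a spider this can be a path on three vertices, so the remaining graph is a matching;
alternating along the legs shows how large a matching does not complete a copy of `F`. As `ρ`
increases strictly with the edges, the extremal graph contains the largest such matching.
-/

namespace SpectralSpider

open Finset Matrix

/-! ### The spectral radius as the maximum of a quadratic form -/

section Rayleigh

variable {α : Type*} [Fintype α] [DecidableEq α] {A : Matrix α α ℝ}

lemma posSemidef_sSup_spectrum_smul_one_sub (hA : A.IsHermitian) :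
    (sSup (spectrum ℝ A) • (1 : Matrix α α ℝ) - A).PosSemidef := by
  rw [posSemidef_iff_isHermitian_and_spectrum_nonneg]
  refine ⟨.sub (by simp [IsHermitian]) hA, ?_⟩
  rw [← Algebra.algebraMap_eq_smul_one, ← spectrum.singleton_sub_eq]
  rintro _ ⟨_, rfl, a, ha, rfl⟩
  exact sub_nonneg.2 (le_csSup A.finite_real_spectrum.bddAbove ha)

lemma dotProduct_sSup_spectrum_smul_one_sub_mulVec (y : α → ℝ) :
    star y ⬝ᵥ (sSup (spectrum ℝ A) • (1 : Matrix α α ℝ) - A) *ᵥ y =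
      sSup (spectrum ℝ A) * (y ⬝ᵥ y) - y ⬝ᵥ A *ᵥ y := by
  simp only [star_trivial, sub_mulVec, smul_mulVec, one_mulVec, dotProduct_sub, dotProduct_smul,
    smul_eq_mul]

lemma dotProduct_mulVec_le_sSup_spectrum_mul (hA : A.IsHermitian) (y : α → ℝ) :
    y ⬝ᵥ A *ᵥ y ≤ sSup (spectrum ℝ A) * (y ⬝ᵥ y) := by
  have h := (posSemidef_sSup_spectrum_smul_one_sub hA).dotProduct_mulVec_nonneg y
  rwa [dotProduct_sSup_spectrum_smul_one_sub_mulVec, sub_nonneg] at h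

lemma mulVec_eq_of_sSup_spectrum_mul_le (hA : A.IsHermitian) {y : α → ℝ}
    (hy : sSup (spectrum ℝ A) * (y ⬝ᵥ y) ≤ y ⬝ᵥ A *ᵥ y) :
    A *ᵥ y = sSup (spectrum ℝ A) • y := by
  have hzero := (posSemidef_sSup_spectrum_smul_one_sub hA).dotProduct_mulVec_zero_iff y
  rw [dotProduct_sSup_spectrum_smul_one_sub_mulVec, sub_mulVec, smul_mulVec, one_mulVec] at hzero
  have hle := dotProduct_mulVec_le_sSup_spectrum_mul hA y
  exact (sub_eq_zero.1 (hzero.1 (by linarith))).symm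

lemma exists_ne_zero_mulVec_eq_sSup_spectrum_smul [Nonempty α] (hA : A.IsHermitian) :
    ∃ y : α → ℝ, y ≠ 0 ∧ A *ᵥ y = sSup (spectrum ℝ A) • y := by
  have hmem : sSup (spectrum ℝ A) ∈ Set.range hA.eigenvalues := by
    rw [hA.spectrum_real_eq_range_eigenvalues]
    exact (Set.range_nonempty _).csSup_mem (Set.finite_range _)
  obtain ⟨i, hi⟩ := hmem
  refine ⟨hA.eigenvectorBasis i, fun h0 => ?_, by rw [← hi, hA.mulVec_eigenvectorBasis]⟩
  exact hA.eigenvectorBasis.toBasis.ne_zero i (by ext v; simpa using congrFun h0 v)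

/- Replacing an eigenvector for the largest eigenvalue by its absolute value does not decrease
the Rayleigh quotient, hence gives an eigenvector again. -/
lemma exists_nonneg_mulVec_eq_sSup_spectrum_smul [Nonempty α] (hA : A.IsHermitian)
    (hA0 : ∀ i j, 0 ≤ A i j) :
    ∃ x : α → ℝ, (∀ v, 0 ≤ x v) ∧ (∀ v, x v ≤ 1) ∧ (∃ z, x z = 1) ∧
      A *ᵥ x = sSup (spectrum ℝ A) • x := by
  obtain ⟨y, hy0, hy⟩ := exists_ne_zero_mulVec_eq_sSup_spectrum_smul hA
  have habs : sSup (spectrum ℝ A) * ((|y ·|) ⬝ᵥ (|y ·|)) ≤ (|y ·|) ⬝ᵥ A *ᵥ (|y ·|) := by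
    calc sSup (spectrum ℝ A) * ((|y ·|) ⬝ᵥ (|y ·|)) = y ⬝ᵥ A *ᵥ y := by
          rw [hy, dotProduct_smul, smul_eq_mul]
          simp only [dotProduct, abs_mul_abs_self]
      _ ≤ (|y ·|) ⬝ᵥ A *ᵥ (|y ·|) := by
          simp only [dotProduct, mulVec, mul_sum]
          refine sum_le_sum fun v _ => sum_le_sum fun u _ => (le_abs_self _).trans_eq ?_
          rw [abs_mul, abs_mul, abs_of_nonneg (hA0 v u)]
  have heig := mulVec_eq_of_sSup_spectrum_mul_le hA habs
  obtain ⟨z, hz⟩ := Finite.exists_max (|y ·|)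
  have hzpos : 0 < |y z| := by
    obtain ⟨v, hv⟩ := Function.ne_iff.1 hy0
    exact (abs_pos.2 hv).trans_le (hz v)
  refine ⟨|y z|⁻¹ • (|y ·|), fun v => ?_, fun v => ?_, ⟨z, inv_mul_cancel₀ hzpos.ne'⟩, ?_⟩
  · exact mul_nonneg (inv_nonneg.2 hzpos.le) (abs_nonneg _)
  · exact inv_mul_le_one_of_le₀ (hz v) hzpos.le
  · rw [mulVec_smul, heig, smul_comm]

end Rayleigh

section SpecRadius

variable {α : Type*} [Fintype α] (G : SimpleGraph α) [DecidableRel G.Adj]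

lemma specRadius_eq_sSup_spectrum [DecidableEq α] :
    specRadius G = sSup (spectrum ℝ (G.adjMatrix ℝ)) := by
  unfold specRadius
  congr!

/-- The quadratic form `yᵀ A y` of the adjacency matrix `A` of `G`. -/
def adjForm (y : α → ℝ) : ℝ :=
  ∑ v, y v * ∑ u ∈ G.neighborFinset v, y u

lemma dotProduct_adjMatrix_mulVec_eq_adjForm (y : α → ℝ) :
    y ⬝ᵥ G.adjMatrix ℝ *ᵥ y = adjForm G y := by
  simp only [dotProduct, SimpleGraph.adjMatrix_mulVec_apply, adjForm]

lemma dotProduct_self_eq_sum_sq (y : α → ℝ) : y ⬝ᵥ y = ∑ v, y v ^ 2 := by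
  simp only [dotProduct, sq]

lemma adjForm_le (y : α → ℝ) : adjForm G y ≤ specRadius G * ∑ v, y v ^ 2 := by
  classical
  rw [← dotProduct_adjMatrix_mulVec_eq_adjForm, ← dotProduct_self_eq_sum_sq,
    specRadius_eq_sSup_spectrum]
  exact dotProduct_mulVec_le_sSup_spectrum_mul (G.isHermitian_adjMatrix ℝ) y

lemma sum_neighborFinset_eq_of_le_adjForm {y : α → ℝ}
    (hy : specRadius G * ∑ v, y v ^ 2 ≤ adjForm G y) (v : α) :
    ∑ u ∈ G.neighborFinset v, y u = specRadius G * y v := by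
  classical
  rw [← dotProduct_adjMatrix_mulVec_eq_adjForm, ← dotProduct_self_eq_sum_sq,
    specRadius_eq_sSup_spectrum] at hy
  have h := congrFun (mulVec_eq_of_sSup_spectrum_mul_le (G.isHermitian_adjMatrix ℝ) hy) v
  rwa [SimpleGraph.adjMatrix_mulVec_apply, ← specRadius_eq_sSup_spectrum] at h

lemma adjForm_eq_mul_sum_sq {lam : ℝ} {y : α → ℝ}
    (hy : ∀ v, ∑ u ∈ G.neighborFinset v, y u = lam * y v) :
    adjForm G y = lam * ∑ v, y v ^ 2 := by
  simp only [adjForm, hy, mul_sum]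
  exact sum_congr rfl fun v _ => by ring

lemma exists_perron_vector [Nonempty α] :
    ∃ x : α → ℝ, (∀ v, 0 ≤ x v) ∧ (∀ v, x v ≤ 1) ∧ (∃ z, x z = 1) ∧
      ∀ v, ∑ u ∈ G.neighborFinset v, x u = specRadius G * x v := by
  classical
  obtain ⟨x, hx0, hx1, hz, hx⟩ := exists_nonneg_mulVec_eq_sSup_spectrum_smul
    (G.isHermitian_adjMatrix ℝ) fun i j => by
      rw [SimpleGraph.adjMatrix_apply]; split_ifs <;> norm_num
  refine ⟨x, hx0, hx1, hz, fun v => ?_⟩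
  have h := congrFun hx v
  rwa [SimpleGraph.adjMatrix_mulVec_apply, ← specRadius_eq_sSup_spectrum] at h

omit [DecidableRel G.Adj] in
variable {G} in
lemma specRadius_congr {β : Type*} [Fintype β] {H : SimpleGraph β} (e : G ≃g H) :
    specRadius G = specRadius H := by
  classical
  rw [specRadius_eq_sSup_spectrum, specRadius_eq_sSup_spectrum, ← e.reindex_adjMatrix ℝ,
    ← Matrix.coe_reindexAlgEquiv ℝ ℝ, AlgEquiv.spectrum_eq]

end SpecRadius

/-! ### Comparison of spectral radii -/

section Rejoin

variable {α : Type*} {G : SimpleGraph α} {v : α} {S : Finset α}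

variable (G v S) in
/-- The graph obtained from `G` by deleting all edges at `v` and then joining `v` to the vertices
of `S`. -/
def rejoin : SimpleGraph α :=
  SimpleGraph.fromRel fun u w => (u ≠ v ∧ w ≠ v ∧ G.Adj u w) ∨ (u = v ∧ w ∈ S)

lemma rejoin_adj_self (hv : v ∉ S) (w : α) : (rejoin G v S).Adj v w ↔ w ∈ S := by
  have h : w ∈ S → v ≠ w := fun hw h => hv (h ▸ hw)
  simp only [rejoin, SimpleGraph.fromRel_adj]
  tauto

lemma rejoin_adj_of_ne {u w : α} (hu : u ≠ v) (hw : w ≠ v) :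
    (rejoin G v S).Adj u w ↔ G.Adj u w := by
  have h : G.Adj u w → u ≠ w := G.ne_of_adj
  simp only [rejoin, SimpleGraph.fromRel_adj, G.adj_comm w u]
  tauto

/- A copy of `F` in `rejoin G v S` using `v` is turned into a copy in `G` by moving `v` to an unused
common neighbour of `S`. -/
lemma free_rejoin {V : Type*} [Fintype V] {F : SimpleGraph V} (hG : F.Free G) {B : Finset α}
    (hv : v ∉ S) (hSB : ∀ s ∈ S, ∀ b ∈ B, G.Adj s b) (hB : Fintype.card V ≤ #B) :
    F.Free (rejoin G v S) := by
  classical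
  rintro ⟨f⟩
  have hadj {a b : V} (h : F.Adj a b) : (rejoin G v S).Adj (f a) (f b) := f.toHom.map_adj h
  refine hG ?_
  by_cases hex : ∃ a, f a = v
  · obtain ⟨a, ha⟩ := hex
    obtain ⟨b, hbB, hb⟩ : ∃ b ∈ B, b ∉ (univ.erase a).image f := by
      refine exists_mem_notMem_of_card_lt_card (card_image_le.trans_lt ?_)
      exact (card_lt_card (erase_ssubset (mem_univ a))).trans_le hB
    have hne {u : V} (hu : u ≠ a) : f u ≠ v := fun h => hu (f.injective (h.trans ha.symm))
    have hswap {u : V} (hu : u ≠ a) : Equiv.swap v b (f u) = f u :=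
      Equiv.swap_apply_of_ne_of_ne (hne hu) fun h =>
        hb (mem_image.2 ⟨u, mem_erase.2 ⟨hu, mem_univ u⟩, h⟩)
    have hadj_a {u : V} (hu : F.Adj a u) : G.Adj b (f u) :=
      (hSB _ ((rejoin_adj_self hv _).1 (ha ▸ hadj hu)) b hbB).symm
    refine ⟨⟨⟨Equiv.swap v b ∘ f, fun {u w} huw => ?_⟩,
      (Equiv.injective _).comp f.injective⟩⟩
    simp only [Function.comp_apply]
    by_cases hu : u = a
    · subst hu
      rw [ha, Equiv.swap_apply_left, hswap huw.ne']
      exact hadj_a huw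
    · by_cases hw : w = a
      · subst hw
        rw [ha, Equiv.swap_apply_left, hswap hu]
        exact (hadj_a huw.symm).symm
      · rw [hswap hu, hswap hw]
        exact (rejoin_adj_of_ne (hne hu) (hne hw)).1 (hadj huw)
  · push Not at hex
    exact ⟨⟨⟨f, fun huw => (rejoin_adj_of_ne (hex _) (hex _)).1 (hadj huw)⟩, f.injective⟩⟩

variable [Fintype α] [DecidableRel G.Adj] {x : α → ℝ}

lemma adjForm_eq_add [DecidableEq α] (v : α) (y : α → ℝ) :
    adjForm G y = 2 * (y v * ∑ u ∈ G.neighborFinset v, y u) +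
      ∑ u ∈ univ.erase v, ∑ w ∈ univ.erase v, if G.Adj u w then y u * y w else 0 := by
  have hsum (u : α) : ∑ w ∈ G.neighborFinset u, y w = ∑ w, if G.Adj u w then y w else 0 := by
    rw [SimpleGraph.neighborFinset_eq_filter, sum_filter]
  have herase (u : α) : (∑ w, if G.Adj u w then y w else 0) =
      (if G.Adj v u then y v else 0) + ∑ w ∈ univ.erase v, if G.Adj u w then y w else 0 := by
    rw [← add_sum_erase univ _ (mem_univ v)]
    simp only [G.adj_comm u v]
  rw [adjForm, ← add_sum_erase univ _ (mem_univ v), two_mul, add_assoc, add_right_inj,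
    hsum v, herase v, if_neg G.irrefl, zero_add, mul_sum, ← sum_add_distrib]
  refine sum_congr rfl fun u _ => ?_
  rw [hsum u, herase u, mul_add, mul_sum]
  simp only [mul_ite, mul_zero, mul_comm]

lemma adjForm_rejoin [DecidableRel (rejoin G v S).Adj] (hv : v ∉ S) (y : α → ℝ) :
    adjForm (rejoin G v S) y =
      adjForm G y + 2 * (y v * (∑ w ∈ S, y w - ∑ w ∈ G.neighborFinset v, y w)) := by
  classical
  have hN : (rejoin G v S).neighborFinset v = S := by
    ext w
    rw [SimpleGraph.mem_neighborFinset, rejoin_adj_self hv]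
  have hrest : (∑ u ∈ univ.erase v, ∑ w ∈ univ.erase v,
      if (rejoin G v S).Adj u w then y u * y w else 0) =
        ∑ u ∈ univ.erase v, ∑ w ∈ univ.erase v, if G.Adj u w then y u * y w else 0 := by
    refine sum_congr rfl fun u hu => sum_congr rfl fun w hw => if_congr ?_ rfl rfl
    exact rejoin_adj_of_ne (ne_of_mem_erase hu) (ne_of_mem_erase hw)
  rw [adjForm_eq_add v, adjForm_eq_add (G := G) v, hN, hrest]
  ring

/- Otherwise `x` is an eigenvector of both graphs. Comparing the two eigenvalue equations at `w₀`
gives `x v = 0`, and the equation at `v` in the new graph then gives `∑ w ∈ S, x w = 0`. -/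
lemma specRadius_lt_rejoin (hx0 : ∀ u, 0 ≤ x u)
    (hx : ∀ u, ∑ w ∈ G.neighborFinset u, x w = specRadius G * x u) (hv : v ∉ S) {w₀ : α}
    (hw₀ : w₀ ∈ S) (hw₀v : ¬ G.Adj w₀ v) (hle : ∑ w ∈ G.neighborFinset v, x w ≤ ∑ w ∈ S, x w)
    (hS : 0 < ∑ w ∈ S, x w) : specRadius G < specRadius (rejoin G v S) := by
  classical
  by_contra! hspec
  have hform : specRadius G * ∑ u, x u ^ 2 ≤ adjForm (rejoin G v S) x := by
    rw [adjForm_rejoin hv, adjForm_eq_mul_sum_sq G hx]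
    linarith [mul_nonneg (hx0 v) (sub_nonneg.2 hle)]
  have hsq : 0 < ∑ u, x u ^ 2 := by
    obtain ⟨s, -, hs⟩ := exists_lt_of_sum_lt (f := 0) (g := x) (by simpa using hS)
    exact sum_pos' (fun u _ => sq_nonneg (x u)) ⟨s, mem_univ s, pow_pos hs 2⟩
  have heq : specRadius (rejoin G v S) = specRadius G :=
    hspec.antisymm (le_of_mul_le_mul_right (hform.trans (adjForm_le _ x)) hsq)
  have heig := sum_neighborFinset_eq_of_le_adjForm (rejoin G v S) (y := x) (by rwa [heq])
  have hNw₀ : (rejoin G v S).neighborFinset w₀ = insert v (G.neighborFinset w₀) := by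
    ext u
    rw [mem_insert, SimpleGraph.mem_neighborFinset, SimpleGraph.mem_neighborFinset]
    rcases eq_or_ne u v with rfl | hu
    · simp only [true_or, SimpleGraph.adj_comm _ w₀, rejoin_adj_self hv, hw₀]
    · rw [rejoin_adj_of_ne (ne_of_mem_of_not_mem hw₀ hv) hu, or_iff_right hu]
  have hxv : x v = 0 := by
    have h := heig w₀
    rwa [hNw₀, sum_insert (by rwa [SimpleGraph.mem_neighborFinset]), hx, heq,
      add_eq_right] at h
  have hNv : (rejoin G v S).neighborFinset v = S := by
    ext u
    rw [SimpleGraph.mem_neighborFinset, rejoin_adj_self hv]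
  have h := heig v
  rw [hNv, hxv, mul_zero] at h
  exact hS.ne' h

end Rejoin

section Comparison

variable {α : Type*} [Fintype α] {G : SimpleGraph α} [DecidableRel G.Adj]

lemma le_specRadius_of_mul_le {c : ℝ} {y : α → ℝ} (hy : ∀ v, 0 ≤ y v) {z : α} (hz : 0 < y z)
    (hc : ∀ v, c * y v ≤ ∑ u ∈ G.neighborFinset v, y u) : c ≤ specRadius G := by
  have hsq : 0 < ∑ v, y v ^ 2 :=
    sum_pos' (fun v _ => sq_nonneg (y v)) ⟨z, mem_univ z, pow_pos hz 2⟩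
  refine le_of_mul_le_mul_right ?_ hsq
  calc c * ∑ v, y v ^ 2 = ∑ v, y v * (c * y v) := by
        rw [mul_sum]
        exact sum_congr rfl fun v _ => by ring
    _ ≤ adjForm G y := sum_le_sum fun v _ => mul_le_mul_of_nonneg_left (hc v) (hy v)
    _ ≤ specRadius G * ∑ v, y v ^ 2 := adjForm_le G y

/- The test vector is the Perron vector of the complete bipartite graph between `S` and `Sᶜ`. -/
omit [DecidableRel G.Adj] in
lemma sqrt_le_specRadius [DecidableEq α] {S : Finset α} (hS : S.Nonempty) (hSc : Sᶜ.Nonempty)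
    (hdom : ∀ s ∈ S, ∀ v, v ∉ S → G.Adj s v) :
    √((#S : ℝ) * (Fintype.card α - #S)) ≤ specRadius G := by
  classical
  obtain ⟨z, hz⟩ := hSc
  have hcompl : (#Sᶜ : ℝ) = Fintype.card α - #S := by
    rw [card_compl, Nat.cast_sub (card_le_univ S)]
  set y : α → ℝ := fun v => if v ∈ S then √(#Sᶜ : ℝ) else √(#S : ℝ)
  have hy (v : α) : 0 ≤ y v := by
    simp only [y]
    split_ifs <;> exact Real.sqrt_nonneg _
  have hsum {T : Finset α} {c : ℝ} {v : α} (hc : ∀ u ∈ T, G.Adj v u ∧ y u = c) :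
      #T * c ≤ ∑ u ∈ G.neighborFinset v, y u := by
    rw [← nsmul_eq_mul, ← sum_const, sum_congr rfl fun u hu => (hc u hu).2.symm]
    exact sum_le_sum_of_subset_of_nonneg
      (fun u hu => (G.mem_neighborFinset v u).2 (hc u hu).1) fun u _ _ => hy u
  have hmul (v : α) : √(#S * #Sᶜ) * y v ≤ ∑ u ∈ G.neighborFinset v, y u := by
    rw [Real.sqrt_mul (Nat.cast_nonneg _)]
    by_cases hv : v ∈ S
    · refine le_trans (le_of_eq ?_)
        (hsum (T := Sᶜ) fun u hu => ⟨hdom v hv u (mem_compl.1 hu), if_neg (mem_compl.1 hu)⟩)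
      simp only [y, if_pos hv, mul_assoc, Real.mul_self_sqrt (Nat.cast_nonneg _)]
      exact mul_comm _ _
    · refine le_trans (le_of_eq ?_) (hsum (T := S) fun u hu => ⟨(hdom u hu v hv).symm, if_pos hu⟩)
      simp only [y, if_neg hv, mul_right_comm _ _ √(#S : ℝ),
        Real.mul_self_sqrt (Nat.cast_nonneg _)]
  rw [← hcompl]
  refine le_specRadius_of_mul_le hy (z := z) ?_ hmul
  simp only [y, if_neg (mem_compl.1 hz)]
  exact Real.sqrt_pos.2 (Nat.cast_pos.2 hS.card_pos)

lemma specRadius_lt_of_lt {H : SimpleGraph α} (hGH : G < H) {x : α → ℝ} (hx0 : ∀ v, 0 < x v)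
    (hx : ∀ v, ∑ u ∈ G.neighborFinset v, x u = specRadius G * x v) :
    specRadius G < specRadius H := by
  classical
  obtain ⟨v, u, hvu, hG⟩ : ∃ v u, H.Adj v u ∧ ¬ G.Adj v u := by
    simpa only [SimpleGraph.le_iff_adj, not_forall, exists_prop] using hGH.not_ge
  have hsub (w : α) : G.neighborFinset w ⊆ H.neighborFinset w := by
    intro u hu
    exact (H.mem_neighborFinset w u).2 (hGH.le ((G.mem_neighborFinset w u).1 hu))
  have hle (w : α) : ∑ u ∈ G.neighborFinset w, x u ≤ ∑ u ∈ H.neighborFinset w, x u :=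
    sum_le_sum_of_subset_of_nonneg (hsub w) fun u _ _ => (hx0 u).le
  by_contra! hρ
  have hform : specRadius H * ∑ w, x w ^ 2 ≤ adjForm H x := by
    calc specRadius H * ∑ w, x w ^ 2 ≤ specRadius G * ∑ w, x w ^ 2 := by gcongr
      _ = adjForm G x := (adjForm_eq_mul_sum_sq G hx).symm
      _ ≤ adjForm H x := sum_le_sum fun w _ => mul_le_mul_of_nonneg_left (hle w) (hx0 w).le
  have hlt : ∑ w ∈ G.neighborFinset v, x w < ∑ w ∈ H.neighborFinset v, x w :=
    sum_lt_sum_of_subset (hsub v) ((H.mem_neighborFinset v u).2 hvu)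
      (fun h => hG ((G.mem_neighborFinset v u).1 h)) (hx0 u) fun w _ _ => (hx0 w).le
  rw [hx, sum_neighborFinset_eq_of_le_adjForm H hform] at hlt
  exact (mul_le_mul_of_nonneg_right hρ (hx0 v).le).not_gt hlt

end Comparison

/-! ### Copies of trees and sparsity -/

section Embedding

variable {V α : Type*} {F : SimpleGraph V} {G : SimpleGraph α}

lemma exists_injective_extend [Fintype V] {W : Finset V} {B : Finset α} {f₀ : V → α}
    (hW : ∀ v ∈ W, f₀ v ∈ B) (hf₀ : Set.InjOn f₀ W) (hB : Fintype.card V ≤ #B) :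
    ∃ f : V → α, Function.Injective f ∧ (∀ v, f v ∈ B) ∧ ∀ v ∈ W, f v = f₀ v := by
  classical
  obtain ⟨t, hWt, htB, ht⟩ := exists_subsuperset_card_eq (image_subset_iff.2 hW)
    (card_image_le.trans (card_le_univ W)) hB
  obtain ⟨e, he⟩ := exists_equiv_extend_of_card_eq ht.symm hWt hf₀
  exact ⟨fun v => e v, Subtype.val_injective.comp e.injective, fun v => htB (e v).2, he⟩

lemma isContained_of_split [Fintype V] {S B : Finset α} (hSB : ∀ s ∈ S, ∀ b ∈ B, G.Adj s b)
    {T W : Finset V} {f₀ : V → α} (hT : #T ≤ #S) (hB : Fintype.card V ≤ #B)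
    (hW : ∀ v ∈ W, f₀ v ∈ B) (hf₀ : Set.InjOn f₀ W) (hTind : ∀ u ∈ T, ∀ v ∈ T, ¬ F.Adj u v)
    (hrest : ∀ u v, u ∉ T → v ∉ T → F.Adj u v → u ∈ W ∧ v ∈ W ∧ G.Adj (f₀ u) (f₀ v)) :
    F.IsContained G := by
  classical
  rcases isEmpty_or_nonempty V with hV | ⟨⟨v₀⟩⟩
  · exact SimpleGraph.IsContained.of_isEmpty
  have : Nonempty α := ⟨f₀ v₀⟩
  obtain ⟨g, hgS, hg⟩ := T.finite_toSet.exists_injOn_of_encard_le (t := (S : Set α))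
    (by simpa only [Set.encard_coe_eq_coe_finsetCard, Nat.cast_le] using hT)
  obtain ⟨h, hh, hhB, hhW⟩ := exists_injective_extend hW hf₀ hB
  refine ⟨⟨⟨T.piecewise g h, fun {u v} huv => ?_⟩, ?_⟩⟩
  · by_cases hu : u ∈ T <;> by_cases hv : v ∈ T
    · exact absurd huv (hTind u hu v hv)
    · rw [piecewise_eq_of_mem _ _ _ hu, piecewise_eq_of_notMem _ _ _ hv]
      exact hSB _ (hgS hu) _ (hhB v)
    · rw [piecewise_eq_of_notMem _ _ _ hu, piecewise_eq_of_mem _ _ _ hv]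
      exact (hSB _ (hgS hv) _ (hhB u)).symm
    · obtain ⟨huW, hvW, hadj⟩ := hrest u v hu hv huv
      rwa [piecewise_eq_of_notMem _ _ _ hu, piecewise_eq_of_notMem _ _ _ hv, hhW u huW, hhW v hvW]
  · change Function.Injective (T.piecewise g h)
    rw [← piecewise_coe, Set.injective_piecewise_iff]
    exact ⟨hg, hh.injOn, fun u hu v _ => (hSB _ (hgS hu) _ (hhB v)).ne⟩

variable (F G) in
/-- The map `f` embeds the subgraph of `F` induced on `s` into `G`, not necessarily as an induced
subgraph. The values of `f` outside `s` are irrelevant. -/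
def IsPartialCopy (s : Finset V) (f : V → α) : Prop :=
  Set.InjOn f s ∧ ∀ u ∈ s, ∀ v ∈ s, F.Adj u v → G.Adj (f u) (f v)

lemma IsPartialCopy.insert [DecidableEq V] {s : Finset V} {f : V → α}
    (h : IsPartialCopy F G s f) {a : V} {b : α} (ha : a ∉ s) (hb : ∀ v ∈ s, f v ≠ b)
    (hadj : ∀ u ∈ s, F.Adj u a → G.Adj (f u) b) :
    IsPartialCopy F G (insert a s) (Function.update f a b) := by
  have hf : ∀ v ∈ s, Function.update f a b v = f v := fun v hv =>
    Function.update_of_ne (ne_of_mem_of_not_mem hv ha) b f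
  refine ⟨?_, ?_⟩
  · rw [coe_insert, Set.injOn_insert ha, Function.update_self]
    refine ⟨h.1.congr fun v hv => (hf v hv).symm, ?_⟩
    rintro ⟨v, hv, hvb⟩
    exact hb v hv ((hf v hv).symm.trans hvb)
  · intro u hu v hv huv
    rcases mem_insert.1 hu with hua | hus <;> rcases mem_insert.1 hv with hva | hvs
    · exact absurd (hua.trans hva.symm) huv.ne
    · rw [hua, hf v hvs, Function.update_self]
      exact (hadj v hvs (hua ▸ huv.symm)).symm
    · rw [hva, hf u hus, Function.update_self]
      exact hadj u hus (hva ▸ huv)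
    · rw [hf u hus, hf v hvs]
      exact h.2 u hus v hvs huv

lemma eq_of_adj_of_dist_le (hF : F.IsTree) (r : V) {a u v : V} (hu : F.Adj a u) (hv : F.Adj a v)
    (hur : F.dist r u ≤ F.dist r a) (hvr : F.dist r v ≤ F.dist r a) : u = v := by
  obtain ⟨p, hp, hlen⟩ := hF.connected.exists_path_of_dist r a
  have hpen {w : V} (hw : F.Adj a w) (hwr : F.dist r w ≤ F.dist r a) : w = p.penultimate := by
    obtain ⟨q, hq, hqlen⟩ := hF.connected.exists_path_of_dist r w
    have hwa : F.dist r a = F.dist r w + 1 := by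
      have := hF.dist_eq_dist_add_one_of_adj r hw
      lia
    have haq : a ∉ q.support := fun haq => by
      have := congrArg SimpleGraph.Walk.length (hF.isAcyclic.path_concat hp hq hw haq)
      rw [SimpleGraph.Walk.length_concat] at this
      lia
    exact hF.isAcyclic.eq_penultimate_of_adj_end hp hw
      (hF.isAcyclic.mem_support_of_ne_mem_support_of_adj_of_isPath hp hq hw haq)
  rw [hpen hu hur, hpen hv hvr]

/- Greedy embedding, in the order of the distance from a root: a new vertex has at most one
neighbour among the vertices which have already been embedded. -/
lemma isContained_of_isTree [Fintype V] [DecidableRel G.Adj] (hF : F.IsTree) {W : Finset α}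
    (hW : W.Nonempty) (h : ∀ w ∈ W, Fintype.card V ≤ #{u ∈ W | G.Adj w u}) :
    F.IsContained G := by
  classical
  obtain ⟨w₀, hw₀⟩ := hW
  have : Nonempty V := hF.connected.nonempty
  let r : V := Classical.arbitrary V
  have key (s : Finset V) : ∃ f : V → α, (∀ v ∈ s, f v ∈ W) ∧ IsPartialCopy F G s f := by
    induction s using Finset.induction_on_max_value (F.dist r) with
    | empty => exact ⟨fun _ => w₀, by simp [IsPartialCopy]⟩
    | insert a s ha hmax ih =>
      obtain ⟨f, hfW, hf⟩ := ih
      have hnew : ∀ w ∈ W, ∃ b ∈ W, G.Adj w b ∧ b ∉ s.image f := by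
        intro w hw
        have hs : #(s.image f) < Fintype.card V :=
          card_image_le.trans_lt (card_lt_univ_of_notMem ha)
        obtain ⟨b, hb, hbs⟩ := exists_mem_notMem_of_card_lt_card (hs.trans_le (h w hw))
        exact ⟨b, (mem_filter.1 hb).1, (mem_filter.1 hb).2, hbs⟩
      obtain ⟨b, hbW, hbs, hadj⟩ : ∃ b ∈ W, b ∉ s.image f ∧
          ∀ u ∈ s, F.Adj u a → G.Adj (f u) b := by
        by_cases hpar : ∃ u ∈ s, F.Adj u a
        · obtain ⟨u, hu, hua⟩ := hpar
          obtain ⟨b, hbW, hub, hbs⟩ := hnew (f u) (hfW u hu)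
          refine ⟨b, hbW, hbs, fun v hv hva => ?_⟩
          rwa [eq_of_adj_of_dist_le hF r hva.symm hua.symm (hmax v hv) (hmax u hu)]
        · push Not at hpar
          obtain ⟨b, hbW, -, hbs⟩ := hnew w₀ hw₀
          exact ⟨b, hbW, hbs, fun u hu hua => absurd hua (hpar u hu)⟩
      refine ⟨Function.update f a b, forall_mem_insert _ _ _ |>.2 ⟨by simpa, fun v hv => ?_⟩,
        hf.insert ha (fun v hv h => hbs (mem_image.2 ⟨v, hv, h⟩)) hadj⟩
      rw [Function.update_of_ne (ne_of_mem_of_not_mem hv ha)]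
      exact hfW v hv
  obtain ⟨f, -, hinj, hadj⟩ := key univ
  exact ⟨⟨⟨f, fun {u v} huv => hadj u (mem_univ u) v (mem_univ v) huv⟩,
    fun u v huv => hinj (mem_univ u) (mem_univ v) huv⟩⟩

end Embedding

section Sparse

variable {α : Type*}

/-- Every vertex set `W` spans at most `ℓ * #W` edges of `G`; the sum counts each edge twice. -/
def IsSparse (ℓ : ℕ) (G : SimpleGraph α) [DecidableRel G.Adj] : Prop :=
  ∀ W : Finset α, ∑ u ∈ W, #{v ∈ W | G.Adj u v} ≤ 2 * ℓ * #W

variable {G : SimpleGraph α} [DecidableRel G.Adj] {ℓ : ℕ}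

lemma isSparse_of_free {V : Type*} [Fintype V] {F : SimpleGraph V} (hF : F.IsTree)
    (hG : F.Free G) : IsSparse (Fintype.card V) G := by
  classical
  intro W
  induction W using Finset.strongInduction with
  | H W ih =>
    rcases W.eq_empty_or_nonempty with rfl | hW
    · simp
    obtain ⟨w, hw, hdeg⟩ : ∃ w ∈ W, #{u ∈ W | G.Adj w u} < Fintype.card V := by
      by_contra! h
      exact hG (isContained_of_isTree hF hW h)
    have hsum : ∑ u ∈ W, #{v ∈ W | G.Adj u v} =
        2 * #{v ∈ W | G.Adj w v} + ∑ u ∈ W.erase w, #{v ∈ W.erase w | G.Adj u v} := by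
      have hsplit (u : α) : #{v ∈ W | G.Adj u v} =
          (if G.Adj w u then 1 else 0) + #{v ∈ W.erase w | G.Adj u v} := by
        simp only [card_filter, ← add_sum_erase W _ hw, G.adj_comm w u]
      rw [← add_sum_erase W _ hw, sum_congr rfl fun u _ => hsplit u, sum_add_distrib,
        ← card_filter, hsplit w, if_neg G.irrefl]
      ring
    have hcard := card_erase_add_one hw
    have := ih (W.erase w) (erase_ssubset hw)
    rw [hsum, ← hcard]
    linarith

lemma IsSparse.sum_le (h : IsSparse ℓ G) (P Q : Finset α) :
    ∑ u ∈ P, #{v ∈ Q | G.Adj u v} ≤ 2 * ℓ * (#P + #Q) := by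
  classical
  calc ∑ u ∈ P, #{v ∈ Q | G.Adj u v} ≤ ∑ u ∈ P ∪ Q, #{v ∈ Q | G.Adj u v} :=
        sum_le_sum_of_subset subset_union_left
    _ ≤ ∑ u ∈ P ∪ Q, #{v ∈ P ∪ Q | G.Adj u v} :=
        sum_le_sum fun u _ => card_le_card (filter_subset_filter _ subset_union_right)
    _ ≤ 2 * ℓ * #(P ∪ Q) := h _
    _ ≤ 2 * ℓ * (#P + #Q) := Nat.mul_le_mul_left _ (card_union_le P Q)

end Sparse

/-! ### Heavy vertices of a Perron vector -/

section Weights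

variable {α : Type*} [Fintype α] (G : SimpleGraph α) [DecidableRel G.Adj]

/-- The vertices whose weight is at least `ε`. -/
noncomputable def heavySet (x : α → ℝ) (ε : ℝ) : Finset α := {w | ε ≤ x w}

/-- The total weight of the neighbours of `u` whose weight is at least `ε`. -/
noncomputable def heavySum (x : α → ℝ) (ε : ℝ) (u : α) : ℝ := ∑ w ∈ heavySet x ε with G.Adj u w, x w

/-- The common neighbours of the vertices in `S`. -/
def commonNeighborFinset (S : Finset α) : Finset α := {b | ∀ s ∈ S, G.Adj s b}

variable {G}

@[simp]
lemma mem_heavySet {x : α → ℝ} {ε : ℝ} {w : α} : w ∈ heavySet x ε ↔ ε ≤ x w := by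
  simp [heavySet]

@[simp]
lemma mem_commonNeighborFinset {S : Finset α} {b : α} :
    b ∈ commonNeighborFinset G S ↔ ∀ s ∈ S, G.Adj s b := by
  simp [commonNeighborFinset]

lemma heavySum_nonneg {x : α → ℝ} (hx : ∀ v, 0 ≤ x v) (ε : ℝ) (u : α) : 0 ≤ heavySum G x ε u :=
  sum_nonneg fun w _ => hx w

lemma heavySum_le_card {x : α → ℝ} (hx : ∀ v, x v ≤ 1) (ε : ℝ) (u : α) :
    heavySum G x ε u ≤ #{w ∈ heavySet x ε | G.Adj u w} := by
  simpa only [heavySum, nsmul_one] using sum_le_card_nsmul _ x 1 fun w _ => hx w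

lemma sum_neighborFinset_le_heavySum_add {x : α → ℝ} {ε : ℝ} (hε : 0 ≤ ε) (u : α) :
    ∑ w ∈ G.neighborFinset u, x w ≤ heavySum G x ε u + ε * G.degree u := by
  rw [heavySum, heavySet, filter_filter, G.neighborFinset_eq_filter,
    ← sum_filter_add_sum_filter_not _ (fun w => ε ≤ x w), filter_filter, filter_filter]
  simp only [and_comm (a := G.Adj u _)]
  gcongr
  calc ∑ w with ¬ ε ≤ x w ∧ G.Adj u w, x w ≤ #{w | ¬ ε ≤ x w ∧ G.Adj u w} • ε :=
        sum_le_card_nsmul _ _ _ fun w hw => (not_le.1 (mem_filter.1 hw).2.1).le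
    _ = ε * #{w | ¬ ε ≤ x w ∧ G.Adj u w} := by rw [nsmul_eq_mul, mul_comm]
    _ ≤ ε * G.degree u := by
        rw [← G.card_neighborFinset_eq_degree, G.neighborFinset_eq_filter]
        gcongr
        exact And.right

end Weights

/-- A sparse graph without complete bipartite subgraphs `K_{k+1,ℓ}`, together with a normalised
nonnegative eigenvector for an eigenvalue `lam ≥ √(k (n - k))`. -/
structure PerronData {α : Type*} [Fintype α] (G : SimpleGraph α) [DecidableRel G.Adj] (k ℓ : ℕ)
    (lam : ℝ) (x : α → ℝ) : Prop where
  k_pos : 1 ≤ k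
  k_le : k ≤ ℓ
  sparse : IsSparse ℓ G
  biclique : ∀ S B : Finset α, #S = k + 1 → (∀ s ∈ S, ∀ b ∈ B, G.Adj s b) → #B < ℓ
  nonneg : ∀ v, 0 ≤ x v
  le_one : ∀ v, x v ≤ 1
  exists_one : ∃ z, x z = 1
  lam_nonneg : 0 ≤ lam
  lam_sq : (k : ℝ) * (Fintype.card α - k) ≤ lam ^ 2
  eigen : ∀ v, ∑ u ∈ G.neighborFinset v, x u = lam * x v

/-- Explicit lower bounds on the order `n` and on the eigenvalue `lam` which make the estimates
below work: `η` is the weight from which on a vertex counts as heavy, and `K` bounds the number of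
heavy vertices. -/
structure Large (k ℓ K : ℕ) (η lam n : ℝ) : Prop where
  eta_pos : 0 < η
  eta_le : 100 * (ℓ : ℝ) ^ 3 * η ≤ 1
  two_mul_le : 2 * (k : ℝ) ≤ n
  lam_large : 512 * (ℓ : ℝ) ^ 3 ≤ lam * η ^ 2
  K_large : 16 * (ℓ : ℝ) ^ 2 ≤ K * η
  n_large : (K : ℝ) * (2 ^ K * ℓ) + k ^ 2 ≤ ℓ * η * n
  ell_le : 2 * (ℓ : ℝ) ≤ ℓ ^ 2 * η * n

lemma exists_large {k ℓ : ℕ} (hk : 1 ≤ k) (hkℓ : k ≤ ℓ) :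
    ∃ (N K : ℕ) (η : ℝ), ∀ (n : ℕ) (lam : ℝ), N ≤ n → 0 ≤ lam → (k : ℝ) * (n - k) ≤ lam ^ 2 →
      Large k ℓ K η lam n := by
  have hk1 : (1 : ℝ) ≤ k := by exact_mod_cast hk
  have hℓ1 : (1 : ℝ) ≤ ℓ := by exact_mod_cast hk.trans hkℓ
  let η : ℝ := 1 / (100 * (ℓ : ℝ) ^ 3)
  have hη0 : 0 < η := by positivity
  obtain ⟨K, hK⟩ := exists_nat_ge (16 * (ℓ : ℝ) ^ 2 / η)
  obtain ⟨N, hN⟩ := exists_nat_ge (2 * (k : ℝ) + 2 * (512 * (ℓ : ℝ) ^ 3 / η ^ 2) ^ 2 +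
    ((K : ℝ) * (2 ^ K * ℓ) + k ^ 2) / (ℓ * η) + 2 * ℓ / (ℓ ^ 2 * η))
  refine ⟨N, K, η, fun n lam hn hlam hsq => ?_⟩
  have hn' : (N : ℝ) ≤ n := by exact_mod_cast hn
  have hlam_term : 0 ≤ 2 * (512 * (ℓ : ℝ) ^ 3 / η ^ 2) ^ 2 := by positivity
  have hK_term : 0 ≤ ((K : ℝ) * (2 ^ K * ℓ) + k ^ 2) / (ℓ * η) := by positivity
  have hℓ_term : 0 ≤ 2 * (ℓ : ℝ) / (ℓ ^ 2 * η) := by positivity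
  have hnk : 2 * (k : ℝ) ≤ n := by linarith
  refine ⟨hη0, (mul_one_div_cancel (by positivity)).le, hnk, ?_, (div_le_iff₀ hη0).1 hK, ?_, ?_⟩
  · rw [← div_le_iff₀ (by positivity)]
    refine le_of_sq_le_sq ?_ hlam
    nlinarith
  · rw [← div_le_iff₀' (by positivity)]
    linarith
  · rw [← div_le_iff₀' (by positivity)]
    linarith

namespace PerronData

variable {α : Type*} [Fintype α] {G : SimpleGraph α} [DecidableRel G.Adj] {k ℓ : ℕ} {lam : ℝ}
  {x : α → ℝ}

lemma card_pos (h : PerronData G k ℓ lam x) : (0 : ℝ) < Fintype.card α := by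
  obtain ⟨z, -⟩ := h.exists_one
  exact_mod_cast Fintype.card_pos_iff.2 ⟨z⟩

lemma one_le_ell (h : PerronData G k ℓ lam x) : (1 : ℝ) ≤ ℓ := by
  exact_mod_cast h.k_pos.trans h.k_le

lemma sum_degree_le (h : PerronData G k ℓ lam x) (A : Finset α) :
    ∑ v ∈ A, (G.degree v : ℝ) ≤ 2 * ℓ * Fintype.card α := by
  have hsum : ∑ v, G.degree v ≤ 2 * ℓ * Fintype.card α := by
    simpa only [← G.card_neighborFinset_eq_degree, G.neighborFinset_eq_filter, card_univ]
      using h.sparse univ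
  exact_mod_cast (sum_le_sum_of_subset (subset_univ A)).trans hsum

/- Split the walks of length two from `v` according to the weight of their end. -/
lemma lam_sq_mul_le (h : PerronData G k ℓ lam x) {ε : ℝ} (hε : 0 ≤ ε) (v : α) :
    lam ^ 2 * x v ≤ ∑ u ∈ G.neighborFinset v, heavySum G x ε u + 2 * ℓ * ε * Fintype.card α := by
  calc lam ^ 2 * x v = ∑ u ∈ G.neighborFinset v, ∑ w ∈ G.neighborFinset u, x w := by
        simp only [h.eigen, ← mul_sum]
        ring
    _ ≤ ∑ u ∈ G.neighborFinset v, (heavySum G x ε u + ε * G.degree u) :=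
        sum_le_sum fun u _ => sum_neighborFinset_le_heavySum_add hε u
    _ = ∑ u ∈ G.neighborFinset v, heavySum G x ε u
          + ε * ∑ u ∈ G.neighborFinset v, (G.degree u : ℝ) := by
        rw [sum_add_distrib, mul_sum]
    _ ≤ ∑ u ∈ G.neighborFinset v, heavySum G x ε u + ε * (2 * ℓ * Fintype.card α) := by
        gcongr
        exact h.sum_degree_le _
    _ = _ := by ring

lemma lam_mul_le_degree (h : PerronData G k ℓ lam x) (v : α) : lam * x v ≤ G.degree v := by
  rw [← h.eigen v, ← G.card_neighborFinset_eq_degree]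
  simpa only [nsmul_one] using sum_le_card_nsmul _ x 1 fun u _ => h.le_one u

lemma mul_card_heavySet_le (h : PerronData G k ℓ lam x) (ε : ℝ) :
    ε * lam * #(heavySet x ε) ≤ 2 * ℓ * Fintype.card α := by
  calc ε * lam * #(heavySet x ε) = #(heavySet x ε) • (lam * ε) := by
        rw [nsmul_eq_mul]
        ring
    _ ≤ ∑ v ∈ heavySet x ε, (G.degree v : ℝ) := card_nsmul_le_sum _ _ _ fun v hv =>
        (mul_le_mul_of_nonneg_left (mem_heavySet.1 hv) h.lam_nonneg).trans (h.lam_mul_le_degree v)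
    _ ≤ 2 * ℓ * Fintype.card α := h.sum_degree_le _

lemma lam_sq_mul_le_degree (h : PerronData G k ℓ lam x) {ε : ℝ} (hε : 0 ≤ ε) (v : α) :
    lam ^ 2 * x v ≤
      2 * ℓ * (G.degree v + #(heavySet x ε)) + 2 * ℓ * ε * Fintype.card α := by
  refine (h.lam_sq_mul_le hε v).trans ?_
  gcongr
  calc ∑ u ∈ G.neighborFinset v, heavySum G x ε u
      ≤ ∑ u ∈ G.neighborFinset v, (#{w ∈ heavySet x ε | G.Adj u w} : ℝ) :=
        sum_le_sum fun u _ => heavySum_le_card h.le_one ε u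
    _ ≤ 2 * ℓ * (#(G.neighborFinset v) + #(heavySet x ε)) := by
        exact_mod_cast h.sparse.sum_le (G.neighborFinset v) (heavySet x ε)
    _ = _ := by rw [G.card_neighborFinset_eq_degree]

lemma half_card_le_lam_sq (h : PerronData G k ℓ lam x) (hn : 2 * (k : ℝ) ≤ Fintype.card α) :
    (Fintype.card α : ℝ) / 2 ≤ lam ^ 2 := by
  have hk1 : (1 : ℝ) ≤ k := by exact_mod_cast h.k_pos
  nlinarith [h.lam_sq]

variable {K : ℕ} {η : ℝ}

/- The preliminary estimate `mul_card_heavySet_le` at the smaller threshold `ε = η / (16 ℓ)` shows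
that the vertices of weight `≥ ε` are too few to matter in `lam_sq_mul_le_degree`. -/
lemma mul_card_le_degree_of_mem_heavySet (h : PerronData G k ℓ lam x)
    (hl : Large k ℓ K η lam (Fintype.card α)) {v : α} (hv : v ∈ heavySet x η) :
    η * Fintype.card α ≤ 8 * ℓ * G.degree v := by
  have hη := hl.eta_pos
  have hℓ1 := h.one_le_ell
  set n : ℝ := (Fintype.card α : ℝ)
  have hlampos : 0 < lam := by
    have : 0 < lam * η ^ 2 := lt_of_lt_of_le (by positivity) hl.lam_large
    exact pos_of_mul_pos_left this (sq_nonneg η)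
  set ε := η / (16 * ℓ) with hεd
  have hε : 0 < ε := by positivity
  have hεℓ : 16 * ℓ * ε = η := by rw [hεd]; field_simp
  have hfew : 2 * ℓ * #(heavySet x ε) ≤ η * n / 8 := by
    refine le_of_mul_le_mul_left ?_ (mul_pos hη hlampos)
    calc η * lam * (2 * ℓ * #(heavySet x ε)) = 32 * ℓ ^ 2 * (ε * lam * #(heavySet x ε)) := by
          rw [← hεℓ]; ring
      _ ≤ 32 * ℓ ^ 2 * (2 * ℓ * n) :=
          mul_le_mul_of_nonneg_left (h.mul_card_heavySet_le ε) (by positivity)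
      _ = 512 * (ℓ : ℝ) ^ 3 * n / 8 := by ring
      _ ≤ lam * η ^ 2 * n / 8 := by
          have := hl.lam_large
          gcongr
      _ = η * lam * (η * n / 8) := by ring
  have hlow : n / 2 * η ≤ lam ^ 2 * x v :=
    mul_le_mul (h.half_card_le_lam_sq hl.two_mul_le) (mem_heavySet.1 hv) hη.le (sq_nonneg _)
  have hup := h.lam_sq_mul_le_degree hε.le v
  have hεn : 2 * ℓ * ε * n = η * n / 8 := by rw [← hεℓ]; ring
  rw [hεn] at hup
  linarith

lemma card_heavySet_le (h : PerronData G k ℓ lam x)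
    (hl : Large k ℓ K η lam (Fintype.card α)) : #(heavySet x η) ≤ K := by
  have hsum : #(heavySet x η) * (η * Fintype.card α) ≤ 8 * ℓ * (2 * ℓ * Fintype.card α) := by
    calc #(heavySet x η) * (η * Fintype.card α)
        = #(heavySet x η) • (η * Fintype.card α) := (nsmul_eq_mul _ _).symm
      _ ≤ ∑ v ∈ heavySet x η, 8 * ℓ * (G.degree v : ℝ) := card_nsmul_le_sum _ _ _ fun v hv =>
          h.mul_card_le_degree_of_mem_heavySet hl hv
      _ = 8 * ℓ * ∑ v ∈ heavySet x η, (G.degree v : ℝ) := (mul_sum _ _ _).symm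
      _ ≤ 8 * ℓ * (2 * ℓ * Fintype.card α) := by gcongr; exact h.sum_degree_le _
  have hcard : #(heavySet x η) * η ≤ K * η :=
    le_trans (le_of_mul_le_mul_right (by linarith) h.card_pos) hl.K_large
  exact_mod_cast le_of_mul_le_mul_right hcard hl.eta_pos

lemma card_exceptional_le (h : PerronData G k ℓ lam x) (L : Finset α) :
    #{u | k < #{w ∈ L | G.Adj u w}} ≤ 2 ^ #L * ℓ := by
  classical
  have hsub : ({u | k < #{w ∈ L | G.Adj u w}} : Finset α) ⊆
      (powersetCard (k + 1) L).biUnion fun S => commonNeighborFinset G S := by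
    intro u hu
    obtain ⟨S, hS, hcard⟩ := exists_subset_card_eq (Nat.succ_le_of_lt (mem_filter.1 hu).2)
    refine mem_biUnion.2 ⟨S, mem_powersetCard.2 ⟨hS.trans (filter_subset _ _), hcard⟩, ?_⟩
    exact mem_commonNeighborFinset.2 fun s hs => (mem_filter.1 (hS hs)).2.symm
  calc #{u | k < #{w ∈ L | G.Adj u w}}
      ≤ #((powersetCard (k + 1) L).biUnion fun S => commonNeighborFinset G S) := card_le_card hsub
    _ ≤ #(powersetCard (k + 1) L) * ℓ := card_biUnion_le_card_mul _ _ ℓ fun S hS =>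
        (h.biclique S _ (mem_powersetCard.1 hS).2 fun s hs b hb =>
          mem_commonNeighborFinset.1 hb s hs).le
    _ ≤ 2 ^ #L * ℓ := by
        rw [← card_powerset]
        gcongr
        exact fun S hS => mem_powerset.2 (mem_powersetCard.1 hS).1

lemma sum_heavySum_le (h : PerronData G k ℓ lam x) (hl : Large k ℓ K η lam (Fintype.card α))
    {κ : ℝ} (hκ : 0 ≤ κ)
    (hsum : ∀ u, #{w ∈ heavySet x η | G.Adj u w} ≤ k → heavySum G x η u ≤ κ) (v : α) :
    ∑ u ∈ G.neighborFinset v, heavySum G x η u ≤ κ * G.degree v + K * (2 ^ K * ℓ) := by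
  classical
  set L := heavySet x η
  have hLK : #L ≤ K := h.card_heavySet_le hl
  set X : Finset α := {u | k < #{w ∈ L | G.Adj u w}}
  have hXcard : (#X : ℝ) ≤ 2 ^ K * ℓ := by
    exact_mod_cast (h.card_exceptional_le L).trans
      (Nat.mul_le_mul_right ℓ (Nat.pow_le_pow_right two_pos hLK))
  have hexc : ∀ u ∈ X, heavySum G x η u ≤ K := fun u _ =>
    (heavySum_le_card h.le_one η u).trans
      (by exact_mod_cast (card_le_card (filter_subset _ _)).trans hLK)
  rw [← sum_filter_add_sum_filter_not _ (· ∉ X)]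
  simp only [not_not]
  refine add_le_add ?_ ?_
  · calc ∑ u ∈ G.neighborFinset v with u ∉ X, heavySum G x η u
        ≤ #{u ∈ G.neighborFinset v | u ∉ X} • κ := sum_le_card_nsmul _ _ _ fun u hu =>
          hsum u (not_lt.1 fun huX => (mem_filter.1 hu).2 (mem_filter.2 ⟨mem_univ u, huX⟩))
      _ ≤ κ * G.degree v := by
        rw [nsmul_eq_mul, mul_comm, ← G.card_neighborFinset_eq_degree]
        gcongr
        exact filter_subset _ _
  · calc ∑ u ∈ G.neighborFinset v with u ∈ X, heavySum G x η u
        ≤ ∑ u ∈ X, heavySum G x η u := sum_le_sum_of_subset_of_nonneg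
          (fun u hu => (mem_filter.1 hu).2) fun u _ _ => heavySum_nonneg h.nonneg η u
      _ ≤ #X • (K : ℝ) := sum_le_card_nsmul _ _ _ hexc
      _ ≤ K * (2 ^ K * ℓ) := by
        rw [nsmul_eq_mul, mul_comm]
        gcongr

lemma card_mul_le_degree_add (h : PerronData G k ℓ lam x)
    (hl : Large k ℓ K η lam (Fintype.card α)) (v : α) :
    Fintype.card α * x v ≤ G.degree v + 3 * ℓ * η * Fintype.card α := by
  have hη := hl.eta_pos
  have hn0 := h.card_pos
  have hk1 : (1 : ℝ) ≤ k := by exact_mod_cast h.k_pos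
  set n : ℝ := (Fintype.card α : ℝ)
  have hwalk := h.lam_sq_mul_le hη.le v
  have hheavy := h.sum_heavySum_le hl (Nat.cast_nonneg k)
    (fun u hu => (heavySum_le_card h.le_one η u).trans (by exact_mod_cast hu)) v
  have hlow : (k : ℝ) * (n - k) * x v ≤ lam ^ 2 * x v :=
    mul_le_mul_of_nonneg_right h.lam_sq (h.nonneg v)
  have hksq : (k : ℝ) ^ 2 * x v ≤ k ^ 2 := mul_le_of_le_one_right (by positivity) (h.le_one v)
  have hkmul : (k : ℝ) * (n * x v) ≤ k * G.degree v + 3 * ℓ * η * n := by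
    linarith [hl.n_large]
  have hk3 : 3 * ℓ * η * n ≤ k * (3 * ℓ * η * n) := le_mul_of_one_le_left (by positivity) hk1
  refine le_of_mul_le_mul_left ?_ (by linarith : (0 : ℝ) < k)
  linarith

lemma four_mul_eta_lt_one (h : PerronData G k ℓ lam x)
    (hl : Large k ℓ K η lam (Fintype.card α)) : 4 * ℓ * η < 1 := by
  have hη := hl.eta_pos
  have hℓ1 := h.one_le_ell
  have hcube : ℓ * η ≤ ℓ ^ 3 * η := by
    gcongr
    exact le_self_pow₀ hℓ1 (by norm_num)
  have : 0 < ℓ * η := by positivity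
  linarith [hl.eta_le]

lemma exists_le_heavySum (h : PerronData G k ℓ lam x)
    (hl : Large k ℓ K η lam (Fintype.card α)) :
    ∃ u, #{w ∈ heavySet x η | G.Adj u w} ≤ k ∧ k - 4 * ℓ * η ≤ heavySum G x η u := by
  have hη := hl.eta_pos
  have hn0 := h.card_pos
  have hk1 : (1 : ℝ) ≤ k := by exact_mod_cast h.k_pos
  have hκ : 0 ≤ k - 4 * ℓ * η := by linarith [h.four_mul_eta_lt_one hl]
  by_contra! hlt
  obtain ⟨z, hz⟩ := h.exists_one
  have hwalk := h.lam_sq_mul_le hη.le z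
  have hheavy := h.sum_heavySum_le hl hκ (fun u hu => (hlt u hu).le) z
  have hdeg : (k - 4 * ℓ * η) * G.degree z ≤ (k - 4 * ℓ * η) * Fintype.card α := by
    gcongr
    exact (G.degree_lt_card_verts z).le
  rw [hz] at hwalk
  have hpos : 0 < ℓ * η * Fintype.card α := by
    have := h.one_le_ell
    positivity
  linarith [h.lam_sq, hl.n_large]

lemma exists_heavy (h : PerronData G k ℓ lam x) (hl : Large k ℓ K η lam (Fintype.card α)) :
    ∃ S : Finset α, #S = k ∧ ∀ w ∈ S, 1 - 4 * ℓ * η ≤ x w := by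
  classical
  obtain ⟨u, huk, hu⟩ := h.exists_le_heavySum hl
  have hcard : #{w ∈ heavySet x η | G.Adj u w} = k := by
    refine le_antisymm huk (Nat.lt_succ_iff.1 ?_)
    have : (k : ℝ) < #{w ∈ heavySet x η | G.Adj u w} + 1 := by
      linarith [hu.trans (heavySum_le_card h.le_one η u), h.four_mul_eta_lt_one hl]
    exact_mod_cast this
  refine ⟨{w ∈ heavySet x η | G.Adj u w}, hcard, fun w hw => ?_⟩
  have herase : ∑ w' ∈ {w ∈ heavySet x η | G.Adj u w}.erase w, x w' ≤ k - 1 := by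
    have := sum_le_card_nsmul ({w ∈ heavySet x η | G.Adj u w}.erase w) x 1 fun w' _ => h.le_one w'
    rwa [nsmul_one, card_erase_of_mem hw, hcard, Nat.cast_sub h.k_pos, Nat.cast_one] at this
  rw [heavySum, ← add_sum_erase _ _ hw] at hu
  linarith

section HeavyVertices

variable {S : Finset α}

lemma card_compl_commonNeighborFinset_le [DecidableEq α] (h : PerronData G k ℓ lam x)
    (hl : Large k ℓ K η lam (Fintype.card α)) (hSk : #S = k)
    (hSx : ∀ w ∈ S, 1 - 4 * ℓ * η ≤ x w) :
    (#(commonNeighborFinset G S)ᶜ : ℝ) ≤ 7 * ℓ ^ 2 * η * Fintype.card α := by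
  have hη := hl.eta_pos
  have hn0 := h.card_pos
  have hsub : (commonNeighborFinset G S)ᶜ ⊆ S.biUnion fun s => (G.neighborFinset s)ᶜ := by
    intro b hb
    simpa [not_forall] using hb
  have hmiss : ∀ s ∈ S, (#(G.neighborFinset s)ᶜ : ℝ) ≤ 7 * ℓ * η * Fintype.card α := by
    intro s hs
    have hsplit : (G.degree s : ℝ) + #(G.neighborFinset s)ᶜ = Fintype.card α := by
      rw [← G.card_neighborFinset_eq_degree]
      exact_mod_cast card_add_card_compl (G.neighborFinset s)
    have hheavy := mul_le_mul_of_nonneg_left (hSx s hs) hn0.le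
    linarith [h.card_mul_le_degree_add hl s]
  calc (#(commonNeighborFinset G S)ᶜ : ℝ) ≤ ∑ s ∈ S, (#(G.neighborFinset s)ᶜ : ℝ) := by
        exact_mod_cast (card_le_card hsub).trans card_biUnion_le
    _ ≤ #S • (7 * ℓ * η * Fintype.card α) := sum_le_card_nsmul _ _ _ hmiss
    _ ≤ ℓ * (7 * ℓ * η * Fintype.card α) := by
        rw [hSk, nsmul_eq_mul]
        gcongr
        exact h.k_le
    _ = 7 * ℓ ^ 2 * η * Fintype.card α := by ring

lemma le_card_commonNeighborFinset (h : PerronData G k ℓ lam x)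
    (hl : Large k ℓ K η lam (Fintype.card α)) (hSk : #S = k)
    (hSx : ∀ w ∈ S, 1 - 4 * ℓ * η ≤ x w) : ℓ ≤ #(commonNeighborFinset G S) := by
  classical
  have hη := hl.eta_pos
  have hcompl := h.card_compl_commonNeighborFinset_le hl hSk hSx
  have hsplit : (#(commonNeighborFinset G S) : ℝ) + #(commonNeighborFinset G S)ᶜ
      = Fintype.card α := by
    exact_mod_cast card_add_card_compl (commonNeighborFinset G S)
  have hsq : 100 * (ℓ : ℝ) ^ 2 * η * Fintype.card α ≤ 1 * Fintype.card α := by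
    gcongr
    refine le_trans ?_ hl.eta_le
    gcongr
    exacts [h.one_le_ell, by norm_num]
  exact_mod_cast (by linarith [hl.ell_le] : (ℓ : ℝ) ≤ #(commonNeighborFinset G S))

lemma card_neighbors_in_commonNeighborFinset_lt (h : PerronData G k ℓ lam x) (hSk : #S = k)
    {v : α} (hv : v ∉ S) : #{b ∈ commonNeighborFinset G S | G.Adj v b} < ℓ := by
  classical
  refine h.biclique (insert v S) _ (by rw [card_insert_of_notMem hv, hSk]) fun s hs b hb => ?_
  obtain ⟨hbS, hvb⟩ := mem_filter.1 hb
  rcases mem_insert.1 hs with rfl | hs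
  · exact hvb
  · exact mem_commonNeighborFinset.1 hbS s hs

lemma le_of_notMem (h : PerronData G k ℓ lam x) (hl : Large k ℓ K η lam (Fintype.card α))
    (hSk : #S = k) (hSx : ∀ w ∈ S, 1 - 4 * ℓ * η ≤ x w) {v : α} (hv : v ∉ S) :
    x v ≤ 11 * ℓ ^ 2 * η := by
  classical
  have hη := hl.eta_pos
  have hn0 := h.card_pos
  have hdeg : (G.degree v : ℝ) ≤ ℓ + 7 * ℓ ^ 2 * η * Fintype.card α := by
    have hsub : G.neighborFinset v ⊆
        {b ∈ commonNeighborFinset G S | G.Adj v b} ∪ (commonNeighborFinset G S)ᶜ := by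
      intro b hb
      by_cases hbB : b ∈ commonNeighborFinset G S
      · exact mem_union_left _ (mem_filter.2 ⟨hbB, (G.mem_neighborFinset v b).1 hb⟩)
      · exact mem_union_right _ (mem_compl.2 hbB)
    rw [← G.card_neighborFinset_eq_degree]
    calc (#(G.neighborFinset v) : ℝ)
        ≤ #{b ∈ commonNeighborFinset G S | G.Adj v b} + #(commonNeighborFinset G S)ᶜ := by
          exact_mod_cast (card_le_card hsub).trans (card_union_le _ _)
      _ ≤ ℓ + 7 * ℓ ^ 2 * η * Fintype.card α := add_le_add
          (by exact_mod_cast (h.card_neighbors_in_commonNeighborFinset_lt hSk hv).le)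
          (h.card_compl_commonNeighborFinset_le hl hSk hSx)
  have hlin : (ℓ : ℝ) * η * Fintype.card α ≤ ℓ ^ 2 * η * Fintype.card α := by
    gcongr
    exact le_self_pow₀ h.one_le_ell two_ne_zero
  refine le_of_mul_le_mul_left ?_ hn0
  linarith [h.card_mul_le_degree_add hl v, hl.ell_le]

end HeavyVertices
end PerronData

namespace PerronData

variable {α : Type*} [Fintype α] {G : SimpleGraph α} [DecidableRel G.Adj] {k ℓ K : ℕ}
  {lam η : ℝ} {x : α → ℝ} {S : Finset α}

lemma sum_neighborFinset_le_sum [DecidableEq α] (h : PerronData G k ℓ lam x)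
    (hl : Large k ℓ K η lam (Fintype.card α)) (hSk : #S = k)
    (hSx : ∀ w ∈ S, 1 - 4 * ℓ * η ≤ x w) {v w₀ : α} (hv : v ∉ S) (hw₀ : w₀ ∈ S)
    (hvw₀ : ¬ G.Adj w₀ v)
    (hfew : #{u ∈ (S ∪ commonNeighborFinset G S)ᶜ | G.Adj v u} ≤ 2 * ℓ) :
    ∑ u ∈ G.neighborFinset v, x u ≤ ∑ u ∈ S, x u := by
  have hη := hl.eta_pos
  have hinner : ∑ u ∈ G.neighborFinset v with u ∈ S, x u ≤ ∑ u ∈ S.erase w₀, x u := by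
    refine sum_le_sum_of_subset_of_nonneg (fun u hu => ?_) fun u _ _ => h.nonneg u
    obtain ⟨huv, huS⟩ := mem_filter.1 hu
    refine mem_erase.2 ⟨?_, huS⟩
    rintro rfl
    exact hvw₀ ((G.mem_neighborFinset v u).1 huv).symm
  have hcard : #{u ∈ G.neighborFinset v | u ∉ S} ≤ 3 * ℓ := by
    have hsub : {u ∈ G.neighborFinset v | u ∉ S} ⊆ {b ∈ commonNeighborFinset G S | G.Adj v b} ∪
        {u ∈ (S ∪ commonNeighborFinset G S)ᶜ | G.Adj v u} := by
      intro u
      simp only [mem_filter, mem_union, mem_compl, G.mem_neighborFinset]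
      tauto
    have := (card_le_card hsub).trans (card_union_le _ _)
    have := h.card_neighbors_in_commonNeighborFinset_lt hSk hv
    lia
  have houter : ∑ u ∈ G.neighborFinset v with u ∉ S, x u ≤ 33 * ℓ ^ 3 * η := by
    calc ∑ u ∈ G.neighborFinset v with u ∉ S, x u
        ≤ #{u ∈ G.neighborFinset v | u ∉ S} • (11 * ℓ ^ 2 * η) :=
          sum_le_card_nsmul _ _ _ fun u hu => h.le_of_notMem hl hSk hSx (mem_filter.1 hu).2
      _ ≤ (3 * ℓ : ℕ) • (11 * ℓ ^ 2 * η) := by gcongr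
      _ = 33 * ℓ ^ 3 * η := by
        rw [nsmul_eq_mul]
        push_cast
        ring
  have hsmall : 4 * ℓ * η + 33 * ℓ ^ 3 * η ≤ 1 := by
    have hcube : ℓ * η ≤ ℓ ^ 3 * η := by
      gcongr
      exact le_self_pow₀ h.one_le_ell (by norm_num)
    have : 0 < ℓ ^ 3 * η := by
      have := h.one_le_ell
      positivity
    linarith [hl.eta_le]
  rw [← sum_filter_add_sum_filter_not _ (· ∈ S), ← add_sum_erase S x hw₀]
  linarith [hSx w₀ hw₀]

lemma pos_of_dominating (h : PerronData G k ℓ lam x) (hS : S.Nonempty) (hSpos : ∀ s ∈ S, 0 < x s)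
    (hdom : ∀ s ∈ S, ∀ v, v ∉ S → G.Adj s v) (v : α) : 0 < x v := by
  obtain ⟨s, hs⟩ := hS
  by_cases hv : v ∈ S
  · exact hSpos v hv
  refine (h.nonneg v).lt_of_ne fun h0 => (hSpos s hs).ne' ?_
  refine (sum_eq_zero_iff_of_nonneg fun u _ => h.nonneg u).1 ?_ s
    ((G.mem_neighborFinset v s).2 (hdom s hs v hv).symm)
  rw [h.eigen v, ← h0, mul_zero]

lemma exists_card_filter_adj_le (h : PerronData G k ℓ lam x) {E : Finset α} (hE : E.Nonempty) :
    ∃ v ∈ E, #{u ∈ E | G.Adj v u} ≤ 2 * ℓ := by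
  refine exists_le_of_sum_le hE ?_
  rw [sum_const, smul_eq_mul, mul_comm]
  exact h.sparse E

/- A vertex `v ∉ S` which misses some vertex of the heavy set `S`, and which has few neighbours
among all such vertices, can be rejoined to `S`: this increases the spectral radius. -/
lemma exists_dominating (h : PerronData G k ℓ (specRadius G) x)
    (hl : Large k ℓ K η (specRadius G) (Fintype.card α))
    (hrej : ∀ (v : α) (S B : Finset α), v ∉ S → (∀ s ∈ S, ∀ b ∈ B, G.Adj s b) → ℓ ≤ #B →
      specRadius (rejoin G v S) ≤ specRadius G) :
    (∃ S : Finset α, #S = k ∧ ∀ s ∈ S, ∀ v, v ∉ S → G.Adj s v) ∧ ∀ v, 0 < x v := by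
  classical
  obtain ⟨S, hSk, hSx⟩ := h.exists_heavy hl
  have hSpos : ∀ s ∈ S, 0 < x s := fun s hs => by
    linarith [hSx s hs, h.four_mul_eta_lt_one hl]
  have hSne : S.Nonempty := Finset.card_pos.1 (by rw [hSk]; exact h.k_pos)
  have hall : (S ∪ commonNeighborFinset G S)ᶜ = ∅ := by
    by_contra! hE
    obtain ⟨v, hvE, hfew⟩ := h.exists_card_filter_adj_le hE
    obtain ⟨hvS, w₀, hw₀, hvw₀⟩ : v ∉ S ∧ ∃ w ∈ S, ¬ G.Adj w v := by simpa using hvE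
    have hle := h.sum_neighborFinset_le_sum hl hSk hSx hvS hw₀ hvw₀ hfew
    refine (specRadius_lt_rejoin h.nonneg h.eigen hvS hw₀ hvw₀ hle
      (sum_pos hSpos hSne)).not_ge (hrej v S (commonNeighborFinset G S) hvS ?_
        (h.le_card_commonNeighborFinset hl hSk hSx))
    exact fun s hs b hb => mem_commonNeighborFinset.1 hb s hs
  have hdom : ∀ s ∈ S, ∀ v, v ∉ S → G.Adj s v := by
    intro s hs v hv
    have hvB : v ∈ S ∪ commonNeighborFinset G S := by
      rw [(compl_eq_empty_iff _).1 hall]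
      exact mem_univ v
    exact mem_commonNeighborFinset.1 ((mem_union.1 hvB).resolve_left hv) s hs
  exact ⟨⟨S, hSk, hdom⟩, h.pos_of_dominating hSne hSpos hdom⟩

end PerronData

/-! ### Legs of a spider -/

section Degree

variable {V : Type*} [Fintype V] {F : SimpleGraph V} [DecidableRel F.Adj] {u a b v : V}

lemma eq_or_eq_of_degree_le_two (hu : F.degree u ≤ 2) (ha : F.Adj u a) (hb : F.Adj u b)
    (hab : a ≠ b) (hv : F.Adj u v) : v = a ∨ v = b := by
  classical
  by_contra! hne
  have hsub : {v, a, b} ⊆ F.neighborFinset u := by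
    simp [insert_subset_iff, ha, hb, hv]
  have hcard := card_le_card hsub
  rw [F.card_neighborFinset_eq_degree, card_eq_three.2 ⟨v, a, b, hne.1, hne.2, hab, rfl⟩] at hcard
  lia

lemma eq_of_degree_eq_one (hu : F.degree u = 1) (ha : F.Adj u a) (hb : F.Adj u b) : a = b :=
  card_le_one.1 (F.card_neighborFinset_eq_degree u ▸ hu).le a ((F.mem_neighborFinset u a).2 ha) b
    ((F.mem_neighborFinset u b).2 hb)

end Degree

section Legs

variable {V : Type*} {F : SimpleGraph V} {c : V}

/-- A decomposition of `F` into legs: `g i j` is the vertex at distance `j` from the center `c` on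
the `i`-th leg, which has length `m i`. The values `g i j` with `m i < j` are irrelevant. -/
structure LegSystem {ι : Type*} (F : SimpleGraph V) (c : V) (m : ι → ℕ) (g : ι → ℕ → V) :
    Prop where
  zero : ∀ i, g i 0 = c
  pos : ∀ i, 1 ≤ m i
  inj : ∀ {i i' j j'}, 1 ≤ j → j ≤ m i → 1 ≤ j' → j' ≤ m i' → g i j = g i' j' → i = i' ∧ j = j'
  ne : ∀ {i j}, 1 ≤ j → j ≤ m i → g i j ≠ c
  surj : ∀ v, v = c ∨ ∃ i j, 1 ≤ j ∧ j ≤ m i ∧ v = g i j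
  adj : ∀ {i j}, j < m i → F.Adj (g i j) (g i (j + 1))
  edge : ∀ {u v}, F.Adj u v →
    ∃ i j, j < m i ∧ ((u = g i j ∧ v = g i (j + 1)) ∨ (v = g i j ∧ u = g i (j + 1)))

lemma LegSystem.degree_le_card {ι : Type*} [Fintype V] [DecidableRel F.Adj] [Fintype ι]
    {m : ι → ℕ} {g : ι → ℕ → V} (h : LegSystem F c m g) : F.degree c ≤ Fintype.card ι := by
  classical
  have hsub : F.neighborFinset c ⊆ univ.image (g · 1) := by
    intro v hv
    obtain ⟨i, j, hj, ⟨hc, rfl⟩ | ⟨-, hc⟩⟩ := h.edge ((F.mem_neighborFinset c v).1 hv)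
    · obtain rfl : j = 0 := by
        by_contra hj0
        exact h.ne (by lia) hj.le hc.symm
      exact mem_image_of_mem _ (mem_univ i)
    · exact absurd hc.symm (h.ne (by lia) hj)
  rw [← F.card_neighborFinset_eq_degree]
  exact (card_le_card hsub).trans card_image_le

variable {a b : V} {p : F.Walk c a} {q : F.Walk c b}

lemma eq_and_getVert_eq_of_getVert_eq (hF : F.IsTree) (hp : p.IsPath) (hq : q.IsPath) {i j : ℕ}
    (hi : i ≤ p.length) (hj : j ≤ q.length) (h : p.getVert i = q.getVert j) :
    i = j ∧ ∀ t ≤ i, p.getVert t = q.getVert t := by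
  have htake : p.take i = (q.take j).copy rfl h.symm :=
    (hF.existsUnique_path c _).unique (hp.take i) (by simpa using hq.take j)
  obtain rfl : i = j := by
    have := congrArg SimpleGraph.Walk.length htake
    rwa [SimpleGraph.Walk.length_copy, SimpleGraph.Walk.take_length, SimpleGraph.Walk.take_length,
      min_eq_left hi, min_eq_left hj] at this
  refine ⟨rfl, fun t ht => ?_⟩
  have := congrArg (SimpleGraph.Walk.getVert · t) htake
  simpa only [SimpleGraph.Walk.getVert_copy, SimpleGraph.Walk.take_getVert, min_eq_right ht]
    using this

lemma getVert_ne_start (hp : p.IsPath) {j : ℕ} (hj : 1 ≤ j) (hjp : j ≤ p.length) :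
    p.getVert j ≠ c := by
  intro h
  have := hp.getVert_injOn hjp (Nat.zero_le _) (h.trans p.getVert_zero.symm)
  lia

lemma adj_getVert_pred {j : ℕ} (hj : 1 ≤ j) (hjp : j ≤ p.length) :
    F.Adj (p.getVert j) (p.getVert (j - 1)) := by
  have := p.adj_getVert_succ (i := j - 1) (by lia)
  rw [Nat.sub_add_cancel hj] at this
  exact this.symm

lemma getVert_pred_ne_getVert_succ (hp : p.IsPath) {j : ℕ} (hj : j < p.length) :
    p.getVert (j - 1) ≠ p.getVert (j + 1) := by
  intro h
  have := hp.getVert_injOn (show j - 1 ≤ p.length by lia) (show j + 1 ≤ p.length by lia) h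
  lia

lemma exists_eq_getVert_of_mem_support {v : V} (hv : v ≠ c) (hvp : v ∈ p.support) :
    ∃ j, 1 ≤ j ∧ j ≤ p.length ∧ v = p.getVert j := by
  obtain ⟨j, rfl, hj⟩ := SimpleGraph.Walk.mem_support_iff_exists_getVert.1 hvp
  refine ⟨j, Nat.one_le_iff_ne_zero.2 ?_, hj, rfl⟩
  rintro rfl
  exact hv p.getVert_zero

variable [Fintype V] [DecidableRel F.Adj]

lemma eq_length_of_degree_eq_one (hp : p.IsPath) {j : ℕ} (hj : 1 ≤ j) (hjp : j ≤ p.length)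
    (hdeg : F.degree (p.getVert j) = 1) : j = p.length := by
  refine hjp.eq_of_not_lt fun hlt => getVert_pred_ne_getVert_succ hp hlt ?_
  exact eq_of_degree_eq_one hdeg (adj_getVert_pred hj hjp) (p.adj_getVert_succ hlt)

lemma eq_getVert_pred_or_eq_getVert_succ (hp : p.IsPath) (ha : F.degree a = 1) {j : ℕ} (hj : 1 ≤ j)
    (hjp : j ≤ p.length) (hdeg : F.degree (p.getVert j) ≤ 2) {v : V}
    (hv : F.Adj (p.getVert j) v) :
    v = p.getVert (j - 1) ∨ j < p.length ∧ v = p.getVert (j + 1) := by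
  rcases hjp.lt_or_eq with hlt | rfl
  · exact (eq_or_eq_of_degree_le_two hdeg (adj_getVert_pred hj hjp) (p.adj_getVert_succ hlt)
      (getVert_pred_ne_getVert_succ hp hlt) hv).imp_right fun h => ⟨hlt, h⟩
  · exact Or.inl (eq_of_degree_eq_one (by rwa [p.getVert_length]) hv (adj_getVert_pred hj hjp))

/- Two legs which share a vertex other than `c` can never branch afterwards. -/
lemma eq_of_getVert_eq_of_degree_eq_one (hF : F.IsTree) (hdeg : ∀ v, v ≠ c → F.degree v ≤ 2)
    (hp : p.IsPath) (hq : q.IsPath) (ha : F.degree a = 1) (hb : F.degree b = 1) {j : ℕ}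
    (hj : 1 ≤ j) (hjp : j ≤ p.length) (hjq : j ≤ q.length) (h : p.getVert j = q.getVert j) :
    a = b := by
  have hstay : ∀ t, j ≤ t → t ≤ p.length → t ≤ q.length ∧ p.getVert t = q.getVert t := by
    intro t hjt
    induction t, hjt using Nat.le_induction with
    | base => exact fun _ => ⟨hjq, h⟩
    | succ t hjt ih =>
      intro ht
      obtain ⟨htq, heq⟩ := ih (by lia)
      have hpred : p.getVert (t - 1) = q.getVert (t - 1) :=
        (eq_and_getVert_eq_of_getVert_eq hF hp hq (by lia) htq heq).2 _ (by lia)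
      have hadj : F.Adj (q.getVert t) (p.getVert (t + 1)) := heq ▸ p.adj_getVert_succ ht
      refine (eq_getVert_pred_or_eq_getVert_succ hq hb (by lia) htq
        (hdeg _ (getVert_ne_start hq (by lia) htq)) hadj).resolve_left fun hback => ?_
      exact getVert_pred_ne_getVert_succ hp ht (hpred.trans hback.symm)
  obtain ⟨hle, heq⟩ := hstay p.length hjp le_rfl
  rw [p.getVert_length] at heq
  rw [heq, eq_length_of_degree_eq_one hq (hj.trans hjp) hle (heq ▸ ha), q.getVert_length]

/- Prolong the path from `c` to `v` as far as possible: in a tree it gets stuck only at a leaf. -/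
lemma exists_isPath_mem_support_degree_eq_one (hF : F.IsTree) {v : V} (hv : v ≠ c) :
    ∃ (a : V) (p : F.Walk c a), p.IsPath ∧ v ∈ p.support ∧ F.degree a = 1 := by
  classical
  choose p hp using fun w => (hF.existsUnique_path c w).exists
  obtain ⟨a, ha, hmax⟩ := exists_max_image {w | v ∈ (p w).support} (fun w => (p w).length)
    ⟨v, by simp⟩
  have hva : v ∈ (p a).support := by simpa using ha
  refine ⟨a, p a, hp a, hva, ?_⟩
  have hnil : ¬(p a).Nil := by
    intro hn
    rw [SimpleGraph.Walk.nil_iff_support_eq.1 hn, List.mem_singleton] at hva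
    exact hv hva
  refine le_antisymm (F.card_neighborFinset_eq_degree a ▸ card_le_one.2 fun u hu w hw => ?_)
    ((F.degree_pos_iff_exists_adj a).2 ⟨_, ((p a).adj_penultimate hnil).symm⟩)
  suffices hpen : ∀ u, F.Adj a u → u = (p a).penultimate from
    (hpen u (by simpa using hu)).trans (hpen w (by simpa using hw)).symm
  intro u hadj
  by_cases hsupp : u ∈ (p a).support
  · exact hF.isAcyclic.eq_penultimate_of_adj_end (hp a) hadj hsupp
  · have hconcat : p u = (p a).concat hadj :=
      (hF.existsUnique_path c u).unique (hp u) ((hp a).concat hsupp hadj)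
    have hlen := hmax u (by simp [hconcat, SimpleGraph.Walk.support_concat, hva])
    rw [hconcat, SimpleGraph.Walk.length_concat] at hlen
    lia

lemma legSystem_getVert (hF : F.IsTree) (hdeg : ∀ v, v ≠ c → F.degree v ≤ 2)
    {p : ∀ a, F.Walk c a} (hp : ∀ a, (p a).IsPath) (hc : F.degree c ≠ 1) :
    LegSystem F c (fun i : {v : V // F.degree v = 1} => (p i).length)
      (fun i j => (p i).getVert j) where
  zero i := (p i).getVert_zero
  pos i := by
    refine Nat.one_le_iff_ne_zero.2 fun h0 => hc ?_
    rw [SimpleGraph.Walk.eq_of_length_eq_zero h0]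
    exact i.2
  inj {i i' j j'} hj hji hj' hji' h := by
    obtain rfl := (eq_and_getVert_eq_of_getVert_eq hF (hp i) (hp i') hji hji' h).1
    exact ⟨Subtype.ext <| eq_of_getVert_eq_of_degree_eq_one hF hdeg (hp i) (hp i') i.2 i'.2 hj hji
      hji' h, rfl⟩
  ne {i _} hj hji := getVert_ne_start (hp i) hj hji
  surj v := by
    refine or_iff_not_imp_left.2 fun hv => ?_
    obtain ⟨a, q, hq, hvq, ha⟩ := exists_isPath_mem_support_degree_eq_one hF hv
    obtain rfl : q = p a := (hF.existsUnique_path c a).unique hq (hp a)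
    exact ⟨⟨a, ha⟩, exists_eq_getVert_of_mem_support hv hvq⟩
  adj {i _} hj := (p i).adj_getVert_succ hj
  edge {u v} huv := by
    wlog hu : u ≠ c generalizing u v
    · obtain ⟨i, j, hj, h⟩ := this huv.symm fun hv => huv.ne ((not_not.1 hu).trans hv.symm)
      exact ⟨i, j, hj, h.symm⟩
    obtain ⟨a, q, hq, huq, ha⟩ := exists_isPath_mem_support_degree_eq_one hF hu
    obtain rfl : q = p a := (hF.existsUnique_path c a).unique hq (hp a)
    obtain ⟨j, hj, hjq, rfl⟩ := exists_eq_getVert_of_mem_support hu huq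
    rcases eq_getVert_pred_or_eq_getVert_succ hq ha hj hjq (hdeg _ hu) huv with rfl | ⟨hlt, rfl⟩
    · exact ⟨⟨a, ha⟩, j - 1, by lia, Or.inr ⟨rfl, by rw [Nat.sub_add_cancel hj]⟩⟩
    · exact ⟨⟨a, ha⟩, j, hlt, Or.inl ⟨rfl, rfl⟩⟩

lemma IsCenter.two_le_degree (hc : IsCenter F c) : 2 ≤ F.degree c := by
  rcases hc with h | ⟨h, -⟩ <;> lia

lemma IsSpider.degree_le_two (hF : IsSpider F) (hc : IsCenter F c) {v : V} (hv : v ≠ c) :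
    F.degree v ≤ 2 := by
  rcases hc with h | ⟨-, h⟩
  · by_contra! hlt
    exact hv (hF.2.2 hlt h)
  · exact h v

lemma legCount_eq_card (hF : F.IsTree) {p : ∀ a, F.Walk c a} (hp : ∀ a, (p a).IsPath)
    (P : ℕ → Prop) [DecidablePred P] :
    legCount F c P = #{i : {v : V // F.degree v = 1} | P (p i).length} := by
  rw [← Set.ncard_coe_finset, ← Set.ncard_image_of_injective _ Subtype.val_injective]
  refine congrArg Set.ncard (Set.ext fun v => ⟨?_, ?_⟩)
  · rintro ⟨hv, q, hq, hP⟩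
    obtain rfl : q = p v := (hF.existsUnique_path c v).unique hq (hp v)
    exact ⟨⟨v, hv⟩, by simpa using hP, rfl⟩
  · rintro ⟨⟨v, hv⟩, hP, rfl⟩
    exact ⟨hv, p v, hp v, by simpa using hP⟩

lemma exists_legSystem (hF : IsSpider F) (hc : IsCenter F c) :
    ∃ (m : {v : V // F.degree v = 1} → ℕ) (g : {v : V // F.degree v = 1} → ℕ → V),
      LegSystem F c m g ∧ 2 ≤ Fintype.card {v : V // F.degree v = 1} ∧
      ∀ (P : ℕ → Prop) [DecidablePred P], legCount F c P = #{i | P (m i)} := by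
  choose p hp using fun a => (hF.1.existsUnique_path c a).exists
  have h := legSystem_getVert hF.1 (fun _ => hF.degree_le_two hc) hp (by
    have := hc.two_le_degree
    lia)
  exact ⟨_, _, h, hc.two_le_degree.trans h.degree_le_card, fun P _ => legCount_eq_card hF.1 hp P⟩

end Legs

/-! ### Splittings and the graphs `S_{n,k}^p` -/

section Splits

variable {V α κ κ' : Type*} {F : SimpleGraph V} {k q : ℕ} {P : SimpleGraph κ}

/-- The disjoint union of edges indexed by `κ`. -/
def matchingGraph (κ : Type*) : SimpleGraph (κ × Bool) where
  Adj a b := a.1 = b.1 ∧ a.2 ≠ b.2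
  symm := ⟨fun _ _ h => ⟨h.1.symm, h.2.symm⟩⟩
  loopless := ⟨fun _ h => h.2 rfl⟩

lemma matchingGraph_isContained (e : κ ↪ κ') :
    (matchingGraph κ).IsContained (matchingGraph κ') :=
  ⟨⟨⟨Prod.map e id, fun h => ⟨congrArg e h.1, h.2⟩⟩, e.injective.prodMap Function.injective_id⟩⟩

lemma map_prodCongr_matchingGraph (e : κ ≃ κ') :
    (matchingGraph κ).map (e.prodCongr (Equiv.refl Bool)).toEmbedding = matchingGraph κ' := by
  ext a b
  rw [SimpleGraph.map_adj]
  constructor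
  · rintro ⟨a, b, h, rfl, rfl⟩
    exact ⟨congrArg e h.1, h.2⟩
  · exact fun h => ⟨(e.symm a.1, a.2), (e.symm b.1, b.2), ⟨congrArg e.symm h.1, h.2⟩, by simp,
      by simp⟩

/-- Removing a suitable independent set of at most `k` vertices leaves only edges which form a copy
of a subgraph of `P`. Such an `F` embeds into every graph consisting of `k` dominating vertices and
of a large graph that contains `P`. -/
def Splits (F : SimpleGraph V) (k : ℕ) (P : SimpleGraph κ) : Prop :=
  ∃ (T : Finset V) (e : κ ↪ V), #T ≤ k ∧ (∀ u ∈ T, ∀ v ∈ T, ¬ F.Adj u v) ∧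
    ∀ u v, u ∉ T → v ∉ T → F.Adj u v → (P.map e).Adj u v

lemma Splits.of_iso {P' : SimpleGraph κ'} (h : Splits F k P) (φ : P ≃g P') : Splits F k P' := by
  obtain ⟨T, e, hT, hTind, hrest⟩ := h
  refine ⟨T, φ.symm.toEquiv.toEmbedding.trans e, hT, hTind, fun u v hu hv huv => ?_⟩
  obtain ⟨a, b, hab, rfl, rfl⟩ := (P.map_adj e u v).1 (hrest u v hu hv huv)
  exact (P'.map_adj _ _ _).2 ⟨φ a, φ b, φ.map_adj_iff.2 hab, by simp, by simp⟩

lemma Splits.matchingGraph_congr (h : Splits F k (matchingGraph κ)) (e : κ ≃ κ') :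
    Splits F k (matchingGraph κ') :=
  h.of_iso ⟨e.prodCongr (Equiv.refl Bool), by simp [matchingGraph]⟩

lemma Splits.isContained [Fintype V] [Finite κ] (h : Splits F k P) {G : SimpleGraph α}
    {S B : Finset α} (hS : k ≤ #S) (hSB : ∀ s ∈ S, ∀ b ∈ B, G.Adj s b)
    (hB : Fintype.card V ≤ #B) (hP : P.IsContained (G.induce B)) : F.IsContained G := by
  classical
  have := Fintype.ofFinite κ
  obtain ⟨T, e, hT, hTind, hrest⟩ := h
  obtain ⟨f⟩ := hP
  rcases isEmpty_or_nonempty V with hV | ⟨⟨v₀⟩⟩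
  · exact SimpleGraph.IsContained.of_isEmpty
  obtain ⟨b₀, -⟩ : B.Nonempty := card_pos.1 ((Fintype.card_pos_iff.2 ⟨v₀⟩).trans_le hB)
  set f₀ : V → α := Function.extend e (fun i => f i) fun _ => b₀
  have hf₀ : ∀ i, f₀ (e i) = f i := e.injective.extend_apply _ _
  refine isContained_of_split hSB (T := T) (W := univ.map e) (f₀ := f₀) (hT.trans hS) hB ?_ ?_
    hTind ?_
  · intro v hv
    obtain ⟨i, -, rfl⟩ := mem_map.1 hv
    exact hf₀ i ▸ (f i).2
  · intro u hu v hv huv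
    obtain ⟨i, -, rfl⟩ := mem_map.1 (mem_coe.1 hu)
    obtain ⟨j, -, rfl⟩ := mem_map.1 (mem_coe.1 hv)
    rw [hf₀, hf₀] at huv
    rw [f.injective (Subtype.ext huv)]
  · intro u v hu hv huv
    obtain ⟨i, j, hij, rfl, rfl⟩ := (P.map_adj e u v).1 (hrest u v hu hv huv)
    rw [hf₀, hf₀]
    exact ⟨mem_map_of_mem e (mem_univ i), mem_map_of_mem e (mem_univ j), f.toHom.map_adj hij⟩

end Splits

section Matching

variable {β κ : Type*}

lemma injective_vecThree {a b d : β} (hab : a ≠ b) (hbd : b ≠ d) (had : a ≠ d) :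
    Function.Injective ![a, b, d] := by
  intro i j hij
  fin_cases i <;> fin_cases j <;> simp_all

lemma eq_of_adj_of_adj_of_pathGraph_free {H : SimpleGraph β} (hH : (SimpleGraph.pathGraph 3).Free H)
    {a b d : β} (hab : H.Adj a b) (hbd : H.Adj b d) : a = d := by
  by_contra had
  refine hH ⟨⟨⟨![a, b, d], fun {i j} hij => ?_⟩, injective_vecThree hab.ne hbd.ne had⟩⟩
  rw [SimpleGraph.pathGraph_adj] at hij
  fin_cases i <;> fin_cases j <;> simp_all [H.adj_comm]

lemma exists_eq_map_matchingGraph_edgeSet {H : SimpleGraph β}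
    (hH : ∀ {a b d}, H.Adj a b → H.Adj b d → a = d) :
    ∃ f : H.edgeSet × Bool ↪ β, H = (matchingGraph H.edgeSet).map f := by
  set f : H.edgeSet × Bool → β := fun x => bif x.2 then x.1.1.out.1 else x.1.1.out.2
  have hedge : ∀ e : H.edgeSet, s(f (e, true), f (e, false)) = e.1 := fun e => Quot.out_eq e.1
  have hadj : ∀ e b, H.Adj (f (e, b)) (f (e, !b)) := by
    intro e b
    have htrue : H.Adj (f (e, true)) (f (e, false)) := by
      rw [← H.mem_edgeSet, hedge]
      exact e.2
    cases b
    exacts [htrue.symm, htrue]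
  have hinj : Function.Injective f := by
    rintro ⟨e, b⟩ ⟨e', b'⟩ h
    have hother : f (e, !b) = f (e', !b') := hH (hadj e b).symm (h ▸ hadj e' b')
    obtain rfl : e = e' := Subtype.ext <| by
      rw [← hedge, ← hedge, Sym2.eq_iff]
      clear_value f
      cases b <;> cases b' <;> simp_all only [Bool.not_true, Bool.not_false, and_self, true_or,
        or_true]
    refine Prod.ext rfl (Bool.eq_iff_iff.2 ?_)
    by_contra hb
    obtain rfl : b' = !b := by cases b <;> cases b' <;> simp_all
    exact (hadj e b).ne h
  refine ⟨⟨f, hinj⟩, le_antisymm (fun u v huv => ?_) fun u v huv => ?_⟩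
  · refine ((matchingGraph H.edgeSet).map_adj _ _ _).2 ?_
    rcases Sym2.eq_iff.1 (hedge ⟨s(u, v), huv⟩) with ⟨hu, hv⟩ | ⟨hv, hu⟩
    · exact ⟨(_, true), (_, false), ⟨rfl, by simp⟩, hu, hv⟩
    · exact ⟨(_, false), (_, true), ⟨rfl, by simp⟩, hu, hv⟩
  · obtain ⟨⟨e, b⟩, ⟨-, b'⟩, ⟨rfl, hb⟩, rfl, rfl⟩ :=
      ((matchingGraph H.edgeSet).map_adj _ _ _).1 huv
    obtain rfl : b' = !b := by cases b <;> cases b' <;> simp_all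
    exact hadj e b

lemma exists_eq_map_matchingGraph [Finite β] {H : SimpleGraph β}
    (hH : ∀ {a b d}, H.Adj a b → H.Adj b d → a = d) :
    ∃ (q : ℕ) (f : Fin q × Bool ↪ β), H = (matchingGraph (Fin q)).map f := by
  obtain ⟨f, hf⟩ := exists_eq_map_matchingGraph_edgeSet hH
  have hmap := map_prodCongr_matchingGraph (Finite.equivFin H.edgeSet).symm
  refine ⟨_, ((Finite.equivFin H.edgeSet).symm.prodCongr (Equiv.refl Bool)).toEmbedding.trans f,
    hf.trans ?_⟩
  rw [← hmap, SimpleGraph.map_map]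
  rfl

lemma exists_perm_comp_eq [Finite κ] (ψ φ : κ ↪ β) :
    ∃ g : Equiv.Perm β, ∀ i, g (ψ i) = φ i := by
  have e := (Finite.equivFin κ).symm
  have := Equiv.Perm.isMultiplyPretransitive β (Nat.card κ)
  obtain ⟨g, hg⟩ := MulAction.exists_smul_eq (Equiv.Perm β)
    (e.toEmbedding.trans ψ) (e.toEmbedding.trans φ)
  refine ⟨g, fun i => ?_⟩
  simpa using DFunLike.congr_fun hg (e.symm i)

end Matching

section GraphS

variable {n k p q : ℕ}

lemma graphS_adj_of_lt {u v : Fin n} (huv : u ≠ v) (hu : (u : ℕ) < k) :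
    (graphS n k p).Adj u v :=
  (SimpleGraph.fromRel_adj _ _ _).2 ⟨huv, Or.inl (Or.inl hu)⟩

lemma graphS_adj_pair {i : ℕ} {u v : Fin n} (hi : i < p) (hu : (u : ℕ) = k + 2 * i)
    (hv : (v : ℕ) = k + 2 * i + 1) : (graphS n k p).Adj u v :=
  (SimpleGraph.fromRel_adj _ _ _).2
    ⟨fun h => by rw [h] at hu; lia, Or.inl (Or.inr ⟨i, hi, hu, hv⟩)⟩

lemma graphS_adj_iff {u v : Fin n} (hu : k ≤ (u : ℕ)) (hv : k ≤ (v : ℕ)) :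
    (graphS n k p).Adj u v ↔ ∃ i < p, ((u : ℕ) = k + 2 * i ∧ (v : ℕ) = k + 2 * i + 1) ∨
      ((v : ℕ) = k + 2 * i ∧ (u : ℕ) = k + 2 * i + 1) := by
  constructor
  · intro h
    rw [graphS, SimpleGraph.fromRel_adj] at h
    obtain ⟨-, (h | ⟨i, hi, h⟩) | (h | ⟨i, hi, h⟩)⟩ := h
    · lia
    · exact ⟨i, hi, Or.inl h⟩
    · lia
    · exact ⟨i, hi, Or.inr h⟩
  · rintro ⟨i, hi, ⟨hu, hv⟩ | ⟨hv, hu⟩⟩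
    · exact graphS_adj_pair hi hu hv
    · exact (graphS_adj_pair hi hv hu).symm

lemma exists_embedding_graphS (hn : k + 2 * q ≤ n) (hqp : q ≤ p) :
    ∃ φ : Fin k ⊕ (Fin q × Bool) ↪ Fin n, (∀ j, (φ (.inl j) : ℕ) < k) ∧
      ∀ a b, (matchingGraph (Fin q)).Adj a b → (graphS n k p).Adj (φ (.inr a)) (φ (.inr b)) := by
  set φ : Fin k ⊕ (Fin q × Bool) → Fin n := Sum.elim (fun j => ⟨j, by lia⟩)
    (fun a => ⟨k + 2 * a.1 + a.2.toNat, by have := a.2.toNat_le; lia⟩)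
  have hφ : Function.Injective φ := by
    refine Function.Injective.sumElim (fun i j h => by simpa [Fin.ext_iff] using h) ?_ ?_
    · rintro ⟨i, a⟩ ⟨j, b⟩ h
      rw [Fin.mk.injEq] at h
      cases a <;> cases b <;> simp at h ⊢ <;> lia
    · intro i a h
      rw [Fin.mk.injEq] at h
      lia
  refine ⟨⟨φ, hφ⟩, fun j => j.2, ?_⟩
  rintro ⟨i, a⟩ ⟨-, b⟩ ⟨rfl, hab⟩
  cases a <;> cases b
  · exact absurd rfl hab
  · exact graphS_adj_pair (i.2.trans_le hqp) rfl rfl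
  · exact (graphS_adj_pair (i.2.trans_le hqp) rfl rfl).symm
  · exact absurd rfl hab

lemma exists_perm_le_comap_graphS {G : SimpleGraph (Fin n)} {S : Finset (Fin n)} (hS : #S = k)
    (hpath : (SimpleGraph.pathGraph 3).Free (G.induce (Sᶜ : Finset (Fin n))))
    (hmatch : ∀ q, (matchingGraph (Fin q)).IsContained (G.induce (Sᶜ : Finset (Fin n))) → q ≤ p) :
    ∃ g : Equiv.Perm (Fin n), G ≤ (graphS n k p).comap g := by
  classical
  set H := G.induce (Sᶜ : Finset (Fin n))
  obtain ⟨q, f, hf⟩ := exists_eq_map_matchingGraph (eq_of_adj_of_adj_of_pathGraph_free hpath)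
  set ψ : Fin k ⊕ (Fin q × Bool) ↪ Fin n :=
    ⟨Sum.elim (fun j => (S.equivFinOfCardEq hS).symm j) (fun a => f a),
      (Subtype.val_injective.comp (S.equivFinOfCardEq hS).symm.injective).sumElim
        (Subtype.val_injective.comp f.injective)
        fun j a h => mem_compl.1 (f a).2 (h ▸ ((S.equivFinOfCardEq hS).symm j).2)⟩
  have hn : k + 2 * q ≤ n := by
    have := Fintype.card_le_of_embedding ψ
    simp only [Fintype.card_sum, Fintype.card_prod, Fintype.card_fin, Fintype.card_bool] at this
    lia
  have hqp : q ≤ p := hmatch q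
    ⟨⟨⟨f, fun h => hf ▸ (SimpleGraph.map_adj_apply ..).2 h⟩, f.injective⟩⟩
  obtain ⟨φ, hφk, hφ⟩ := exists_embedding_graphS hn hqp
  obtain ⟨g, hg⟩ := exists_perm_comp_eq ψ φ
  have hgS : ∀ u ∈ S, (g u : ℕ) < k := by
    intro u hu
    have hgu := hg (.inl (S.equivFinOfCardEq hS ⟨u, hu⟩))
    simp only [ψ, Function.Embedding.coeFn_mk, Sum.elim_inl, Equiv.symm_apply_apply] at hgu
    exact hgu ▸ hφk _
  refine ⟨g, fun u v huv => ?_⟩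
  by_cases hu : u ∈ S
  · exact graphS_adj_of_lt (g.injective.ne huv.ne) (hgS u hu)
  by_cases hv : v ∈ S
  · exact (graphS_adj_of_lt (g.injective.ne huv.ne') (hgS v hv)).symm
  have hH : H.Adj ⟨u, mem_compl.2 hu⟩ ⟨v, mem_compl.2 hv⟩ := huv
  rw [hf, SimpleGraph.map_adj] at hH
  obtain ⟨a, b, hab, hau, hbv⟩ := hH
  have hu' : ψ (.inr a) = u := congrArg Subtype.val hau
  have hv' : ψ (.inr b) = v := congrArg Subtype.val hbv
  rw [SimpleGraph.comap_adj, ← hu', ← hv', hg, hg]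
  exact hφ a b hab

end GraphS

/-! ### Extremal graphs of a tree with splittings -/

section Extremal

variable {V : Type*} {n : ℕ} {F : SimpleGraph V} {G : SimpleGraph (Fin n)}

lemma finite_setOf_specRadius :
    {x : ℝ | ∃ G : SimpleGraph (Fin n), F.Free G ∧ specRadius G = x}.Finite :=
  (Set.finite_range fun G : SimpleGraph (Fin n) => specRadius G).subset
    fun _ ⟨G, _, hG⟩ => ⟨G, hG⟩

lemma specRadius_le_spex (hG : F.Free G) : specRadius G ≤ spex n F :=
  le_csSup finite_setOf_specRadius.bddAbove ⟨G, hG, rfl⟩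

lemma SPEX_nonempty (hG : F.Free G) : (SPEX n F).Nonempty :=
  by
  have hne : {x | ∃ G : SimpleGraph (Fin n), F.Free G ∧ specRadius G = x}.Nonempty :=
    ⟨_, G, hG, rfl⟩
  exact hne.csSup_mem finite_setOf_specRadius

lemma specRadius_le_of_mem_SPEX (hG : G ∈ SPEX n F) {H : SimpleGraph (Fin n)} (hH : F.Free H) :
    specRadius H ≤ specRadius G :=
  hG.2 ▸ specRadius_le_spex hH

lemma SPEX_eq_isoClassS_of_forall {k p : ℕ} (hfree : F.Free (graphS n k p))
    (h : ∀ G ∈ SPEX n F, G ∈ isoClassS n k p) : SPEX n F = isoClassS n k p := by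
  refine Set.Subset.antisymm h fun H ⟨hH⟩ => ?_
  obtain ⟨G, hG⟩ := SPEX_nonempty hfree
  obtain ⟨e⟩ := h G hG
  have e' : H ≃g G := hH.trans e.symm
  exact ⟨(SimpleGraph.free_congr_right e').2 hG.1, (specRadius_congr e').trans hG.2⟩

lemma sqrt_le_specRadius_graphS {k : ℕ} (p : ℕ) (hk : 1 ≤ k) (hkn : k < n) :
    √((k : ℝ) * (n - k)) ≤ specRadius (graphS n k p) := by
  have hS : #{v : Fin n | (v : ℕ) < k} = k := by
    rw [Fin.card_filter_val_lt, min_eq_right hkn.le]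
  have h := sqrt_le_specRadius (G := graphS n k p) (S := {v : Fin n | (v : ℕ) < k})
    (card_pos.1 (by lia)) (card_pos.1 (by rw [card_compl, hS, Fintype.card_fin]; lia))
    fun s hs v hv => graphS_adj_of_lt (fun h => hv (h ▸ hs)) (mem_filter.1 hs).2
  rwa [hS, Fintype.card_fin] at h

variable {k p : ℕ}

lemma mem_isoClassS_of_mem_SPEX [DecidableRel G.Adj] (hG : G ∈ SPEX n F)
    (hfree : F.Free (graphS n k p)) {g : Equiv.Perm (Fin n)} (hg : G ≤ (graphS n k p).comap g)
    {x : Fin n → ℝ} (hpos : ∀ v, 0 < x v)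
    (hx : ∀ v, ∑ u ∈ G.neighborFinset v, x u = specRadius G * x v) : G ∈ isoClassS n k p := by
  have e : (graphS n k p).comap g ≃g graphS n k p := SimpleGraph.Iso.comap g _
  obtain rfl | hlt := hg.eq_or_lt
  · exact ⟨e⟩
  · exact absurd (specRadius_le_of_mem_SPEX hG ((SimpleGraph.free_congr_right e).2 hfree))
      (specRadius_lt_of_lt hlt hpos hx).not_ge

variable [Fintype V]

lemma exists_dominating_of_mem_SPEX [NeZero n] (hF : F.IsTree) (hk : 1 ≤ k)
    (hkℓ : k ≤ Fintype.card V) (hcover : Splits F (k + 1) (⊥ : SimpleGraph Empty))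
    (hG : G ∈ SPEX n F) {K : ℕ} {η : ℝ}
    (hlam : √((k : ℝ) * (n - k)) ≤ specRadius G)
    (hlarge : Large k (Fintype.card V) K η (specRadius G) n) [DecidableRel G.Adj] :
    ∃ S : Finset (Fin n), #S = k ∧ (∀ s ∈ S, ∀ v, v ∉ S → G.Adj s v) ∧
      ∃ x : Fin n → ℝ, (∀ v, 0 < x v) ∧
        ∀ v, ∑ u ∈ G.neighborFinset v, x u = specRadius G * x v := by
  obtain ⟨x, hx0, hx1, hz, hx⟩ := exists_perron_vector G
  have hlam0 : 0 ≤ specRadius G := (Real.sqrt_nonneg _).trans hlam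
  have hdata : PerronData G k (Fintype.card V) (specRadius G) x :=
    { k_pos := hk
      k_le := hkℓ
      sparse := isSparse_of_free hF hG.1
      biclique := fun S B hS hSB => not_le.1 fun hB =>
        hG.1 (hcover.isContained hS.ge hSB hB
          ⟨⟨⟨isEmptyElim, fun h => h.elim⟩, Function.injective_of_subsingleton _⟩⟩)
      nonneg := hx0
      le_one := hx1
      exists_one := hz
      lam_nonneg := hlam0
      lam_sq := by rw [Fintype.card_fin]; exact (Real.sqrt_le_left hlam0).1 hlam
      eigen := hx }
  obtain ⟨⟨S, hS, hdom⟩, hpos⟩ := hdata.exists_dominating (by rwa [Fintype.card_fin])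
    fun v S B hv hSB hB => specRadius_le_of_mem_SPEX hG (free_rejoin hG.1 hv hSB hB)
  exact ⟨S, hS, hdom, x, hpos, hx⟩

lemma exists_perm_le_comap_graphS_of_free (hG : F.Free G) {S : Finset (Fin n)} (hS : #S = k)
    (hdom : ∀ s ∈ S, ∀ v, v ∉ S → G.Adj s v) (hn : k + Fintype.card V ≤ n)
    (hpath : Splits F k (SimpleGraph.pathGraph 3))
    (hmatch : (n - k) / 2 ≤ p ∨ Splits F k (matchingGraph (Fin (p + 1)))) :
    ∃ g : Equiv.Perm (Fin n), G ≤ (graphS n k p).comap g := by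
  have hSc : #Sᶜ = n - k := by rw [card_compl, hS, Fintype.card_fin]
  have hsplit {κ : Type} [Finite κ] {P : SimpleGraph κ} (hP : Splits F k P) :
      P.Free (G.induce (Sᶜ : Finset (Fin n))) := fun hcont =>
    hG (hP.isContained hS.ge (fun s hs b hb => hdom s hs b (mem_compl.1 hb)) (by lia) hcont)
  refine exists_perm_le_comap_graphS hS (hsplit hpath) fun q hq => ?_
  rcases hmatch with hp | hp
  · obtain ⟨f⟩ := hq
    have hcard := Fintype.card_le_of_injective (β := (Sᶜ : Finset (Fin n))) f f.injective
    rw [Fintype.card_coe, hSc, Fintype.card_prod, Fintype.card_fin, Fintype.card_bool] at hcard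
    lia
  · exact not_lt.1 fun hpq =>
      hsplit hp ((matchingGraph_isContained (Fin.castLEEmb hpq)).trans hq)

theorem eventually_SPEX_eq_isoClassS (hF : F.IsTree) (hk : 1 ≤ k) (hkℓ : k ≤ Fintype.card V)
    (hcover : Splits F (k + 1) (⊥ : SimpleGraph Empty))
    (hpath : Splits F k (SimpleGraph.pathGraph 3)) {p : ℕ → ℕ}
    (hmatch : ∀ n, (n - k) / 2 ≤ p n ∨ Splits F k (matchingGraph (Fin (p n + 1))))
    (hfree : ∀ n, F.Free (graphS n k (p n))) :
    ∀ᶠ n in Filter.atTop, SPEX n F = isoClassS n k (p n) := by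
  classical
  obtain ⟨N, K, η, hN⟩ := exists_large hk hkℓ
  filter_upwards [Filter.eventually_ge_atTop (N + k + Fintype.card V + 1)] with n hn
  refine SPEX_eq_isoClassS_of_forall (hfree n) fun G hG => ?_
  have : NeZero n := ⟨by lia⟩
  have hlam := (sqrt_le_specRadius_graphS (p n) hk (show k < n by lia)).trans
    (specRadius_le_of_mem_SPEX hG (hfree n))
  have hlam0 : 0 ≤ specRadius G := (Real.sqrt_nonneg _).trans hlam
  obtain ⟨S, hS, hdom, x, hpos, hx⟩ := exists_dominating_of_mem_SPEX hF hk hkℓ hcover hG hlam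
    (hN n _ (by lia) hlam0 ((Real.sqrt_le_left hlam0).1 hlam))
  obtain ⟨g, hg⟩ := exists_perm_le_comap_graphS_of_free hG.1 hS hdom (by lia) hpath (hmatch n)
  exact mem_isoClassS_of_mem_SPEX hG (hfree n) hg hpos hx

end Extremal

/-! ### Splittings of a spider -/

section IndependentCover

variable {V κ : Type*} {F : SimpleGraph V} {T : Finset V}

/-- `T` is an independent vertex cover: every edge has exactly one end in `T`. -/
def IsIndependentCover (F : SimpleGraph V) (T : Finset V) : Prop :=
  ∀ u v, F.Adj u v → (u ∈ T ↔ v ∉ T)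

lemma IsIndependentCover.splits_sdiff {P : SimpleGraph κ}
    (hT : IsIndependentCover F T) {R : Finset V} (hR : R ⊆ T) (e : κ ↪ V)
    (hrest : ∀ r ∈ R, ∀ w, F.Adj r w → (P.map e).Adj r w) : Splits F (#T - #R) P := by
  classical
  refine ⟨T \ R, e, (card_sdiff_of_subset hR).le, fun u hu v hv huv => ?_, fun u v hu hv huv => ?_⟩
  · exact (hT u v huv).1 (sdiff_subset hu) (sdiff_subset hv)
  · have hmem {w} (hw : w ∉ T \ R) (hwT : w ∈ T) : w ∈ R := by
      by_contra hwR
      exact hw (mem_sdiff.2 ⟨hwT, hwR⟩)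
    by_cases huT : u ∈ T
    · exact hrest u (hmem hu huT) v huv
    · exact (hrest v (hmem hv ((hT v u huv.symm).2 huT)) u huv.symm).symm

lemma IsIndependentCover.splits_bot (hT : IsIndependentCover F T) :
    Splits F #T (⊥ : SimpleGraph Empty) := by
  classical
  exact hT.splits_sdiff (empty_subset T) Function.Embedding.ofIsEmpty (by simp)

lemma IsIndependentCover.splits_pathGraph [Fintype V] [DecidableRel F.Adj]
    (hT : IsIndependentCover F T) {r : V} (hr : r ∈ T) (hdeg : F.degree r ≤ 2)
    (hcard : 3 ≤ Fintype.card V) : Splits F (#T - 1) (SimpleGraph.pathGraph 3) := by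
  classical
  obtain ⟨N, hN, hNr, hN2⟩ := exists_subsuperset_card_eq (t := univ.erase r)
    (fun w hw => mem_erase.2 ⟨((F.mem_neighborFinset r w).1 hw).ne', mem_univ w⟩) hdeg
    (by rw [card_erase_of_mem (mem_univ r), card_univ]; lia)
  obtain ⟨a, b, hab, rfl⟩ := card_eq_two.1 hN2
  have ha : a ≠ r := ne_of_mem_erase (hNr (mem_insert_self a _))
  have hb : b ≠ r := ne_of_mem_erase (hNr (mem_insert_of_mem (mem_singleton_self b)))
  refine hT.splits_sdiff (singleton_subset_iff.2 hr)
    ⟨![a, r, b], injective_vecThree ha hb.symm hab⟩ fun r' hr' w hw => ?_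
  obtain rfl := mem_singleton.1 hr'
  rw [SimpleGraph.map_adj]
  have hw' := hN ((F.mem_neighborFinset _ w).2 hw)
  rw [mem_insert, mem_singleton] at hw'
  rcases hw' with rfl | rfl
  · exact ⟨1, 0, by simp [SimpleGraph.pathGraph_adj], rfl, rfl⟩
  · exact ⟨1, 2, by simp [SimpleGraph.pathGraph_adj], rfl, rfl⟩

lemma IsIndependentCover.splits_matchingGraph [Fintype κ] (hT : IsIndependentCover F T)
    {leaf nb : κ → V} (hleaf : Function.Injective leaf) (hnb : Function.Injective nb)
    (hmem : ∀ a, leaf a ∈ T) (hnbT : ∀ a, nb a ∉ T)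
    (hadj : ∀ a w, F.Adj (leaf a) w → w = nb a) :
    Splits F (#T - Fintype.card κ) (matchingGraph κ) := by
  classical
  have hinj : Function.Injective fun x : κ × Bool => bif x.2 then leaf x.1 else nb x.1 := by
    rintro ⟨a, _ | _⟩ ⟨b, _ | _⟩ hab
    · exact Prod.ext (hnb hab) rfl
    · exact absurd (hmem b) ((show nb a = leaf b from hab) ▸ hnbT a)
    · exact absurd (hmem a) ((show leaf a = nb b from hab) ▸ hnbT b)
    · exact Prod.ext (hleaf hab) rfl
  rw [← card_univ, ← card_image_of_injective _ hleaf]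
  refine hT.splits_sdiff (image_subset_iff.2 fun a _ => hmem a) ⟨_, hinj⟩ fun r hr w hw => ?_
  obtain ⟨a, -, rfl⟩ := mem_image.1 hr
  rw [SimpleGraph.map_adj]
  exact ⟨(a, true), (a, false), ⟨rfl, by simp⟩, rfl, (hadj a w hw).symm⟩

end IndependentCover

namespace LegSystem

variable {V ι κ : Type*} {F : SimpleGraph V} {c : V} {m : ι → ℕ} {g : ι → ℕ → V}

lemma eq_or_of_eq (h : LegSystem F c m g) {i i' j j'} (hj : j ≤ m i) (hj' : j' ≤ m i')
    (he : g i j = g i' j') : j = j' ∧ (j = 0 ∨ i = i') := by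
  rcases Nat.eq_zero_or_pos j with rfl | hj0 <;> rcases Nat.eq_zero_or_pos j' with rfl | hj0'
  · exact ⟨rfl, Or.inl rfl⟩
  · exact absurd (he.symm.trans (h.zero i)) (h.ne hj0' hj')
  · exact absurd (he.trans (h.zero i')) (h.ne hj0 hj)
  · obtain ⟨hi, hjj⟩ := h.inj hj0 hj hj0' hj' he
    exact ⟨hjj, Or.inr hi⟩

lemma forall_adj (h : LegSystem F c m g) {P : V → V → Prop} (hsymm : ∀ {u v}, P u v → P v u)
    (hP : ∀ i j, j < m i → P (g i j) (g i (j + 1))) : ∀ u v, F.Adj u v → P u v := by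
  intro u v huv
  obtain ⟨i, j, hj, ⟨rfl, rfl⟩ | ⟨rfl, rfl⟩⟩ := h.edge huv
  exacts [hP i j hj, hsymm (hP i j hj)]

lemma eq_or_eq_of_adj (h : LegSystem F c m g) {i j} (hj0 : 1 ≤ j) (hj : j ≤ m i) {w : V}
    (hw : F.Adj (g i j) w) : w = g i (j - 1) ∨ j < m i ∧ w = g i (j + 1) := by
  obtain ⟨i', j', hj', ⟨he, rfl⟩ | ⟨rfl, he⟩⟩ := h.edge hw
  · obtain ⟨rfl, hi⟩ := h.eq_or_of_eq hj hj'.le he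
    obtain rfl := hi.resolve_left (by lia)
    exact Or.inr ⟨hj', rfl⟩
  · obtain ⟨rfl, hi⟩ := h.eq_or_of_eq hj hj' he
    obtain rfl := hi.resolve_left (by lia)
    exact Or.inl rfl

lemma degree_le_two [Fintype V] [DecidableRel F.Adj] (h : LegSystem F c m g) {i j}
    (hj0 : 1 ≤ j) (hj : j ≤ m i) : F.degree (g i j) ≤ 2 := by
  classical
  rw [← F.card_neighborFinset_eq_degree]
  refine (card_le_card (t := {g i (j - 1), g i (j + 1)}) fun w hw => ?_).trans card_le_two
  rw [mem_insert, mem_singleton]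
  exact (h.eq_or_eq_of_adj hj0 hj ((F.mem_neighborFinset _ w).1 hw)).imp_right And.right

lemma eq_of_adj_leaf (h : LegSystem F c m g) {i} {w : V} (hw : F.Adj (g i (m i)) w) :
    w = g i (m i - 1) :=
  (h.eq_or_eq_of_adj (h.pos i) le_rfl hw).resolve_right fun hlt => hlt.1.false

lemma injective_leaf (h : LegSystem F c m g) : Function.Injective fun i => g i (m i) :=
  fun i i' hii => (h.inj (h.pos i) le_rfl (h.pos i') le_rfl hii).1

section Card

variable [Fintype ι]

lemma card_eq (h : LegSystem F c m g) [DecidableEq V] (T : Finset V) :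
    #T = (if c ∈ T then 1 else 0) + ∑ i, #{j ∈ Ioc 0 (m i) | g i j ∈ T} := by
  have herase : #(T.erase c) = ∑ i, #{j ∈ Ioc 0 (m i) | g i j ∈ T} := by
    rw [← card_sigma]
    refine (card_bij (fun x _ => g x.1 x.2) ?_ ?_ ?_).symm
    · rintro ⟨i, j⟩ hx
      simp only [mem_sigma, mem_univ, true_and, mem_filter, mem_Ioc] at hx
      exact mem_erase.2 ⟨h.ne hx.1.1 hx.1.2, hx.2⟩
    · rintro ⟨i, j⟩ hx ⟨i', j'⟩ hx' he
      simp only [mem_sigma, mem_univ, true_and, mem_filter, mem_Ioc] at hx hx'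
      obtain ⟨rfl, rfl⟩ := h.inj hx.1.1 hx.1.2 hx'.1.1 hx'.1.2 he
      rfl
    · intro v hv
      obtain ⟨hvc, hvT⟩ := mem_erase.1 hv
      obtain rfl | ⟨i, j, hj0, hj, rfl⟩ := h.surj v
      · exact absurd rfl hvc
      · exact ⟨⟨i, j⟩, by simp [Nat.lt_of_succ_le hj0, hj, hvT], rfl⟩
  split_ifs with hc
  · rw [← herase, add_comm, card_erase_add_one hc]
  · rw [← herase, erase_eq_of_notMem hc, zero_add]

lemma card_vertices_eq_one_add_sum [Fintype V] (h : LegSystem F c m g) :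
    Fintype.card V = 1 + ∑ i, m i := by
  classical
  rw [← card_univ, h.card_eq]
  simp

end Card

lemma exists_finset_forall_mem_iff [Finite V] (h : LegSystem F c m g) {Q : ι → ℕ → Prop}
    (hQ : ∀ i i', Q i 0 → Q i' 0) :
    ∃ T : Finset V, ∀ {i j}, j ≤ m i → (g i j ∈ T ↔ Q i j) := by
  classical
  have := Fintype.ofFinite V
  refine ⟨univ.filter fun v => ∃ i j, j ≤ m i ∧ v = g i j ∧ Q i j, fun {i j} hj => ?_⟩
  rw [mem_filter_univ]
  refine ⟨fun ⟨i', j', hj', he, hQ'⟩ => ?_, fun hQ' => ⟨i, j, hj, rfl, hQ'⟩⟩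
  obtain ⟨rfl, rfl | rfl⟩ := h.eq_or_of_eq hj hj' he
  exacts [hQ i' i hQ', hQ']

lemma card_filter_odd_Ioc (n : ℕ) : #{j ∈ Ioc 0 n | Odd j} = (n + 1) / 2 := by
  have hsum := card_filter_add_card_filter_not (s := Ioc 0 n) (2 ∣ ·)
  rw [Nat.Ioc_filter_dvd_card_eq_div, Nat.card_Ioc] at hsum
  simp only [← even_iff_two_dvd, Nat.not_even_iff_odd] at hsum
  lia

lemma three_le_card [Fintype V] (h : LegSystem F c m g) {i₀ : ι} (hi₀ : 2 ≤ m i₀) :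
    3 ≤ Fintype.card V := by
  refine Fintype.two_lt_card_iff.2 ⟨c, g i₀ 1, g i₀ 2, (h.ne le_rfl (h.pos i₀)).symm,
    (h.ne one_le_two hi₀).symm, fun he => ?_⟩
  simpa using (h.inj le_rfl (h.pos i₀) one_le_two hi₀ he).2

section Covers

variable [Finite V] [Fintype ι]

lemma exists_even_cover [Nonempty ι] (h : LegSystem F c m g) :
    ∃ T : Finset V, IsIndependentCover F T ∧ #T = ∑ i, m i / 2 + 1 ∧
      ∀ {i j}, j ≤ m i → (g i j ∈ T ↔ Even j) := by
  classical
  obtain ⟨T, hT⟩ := h.exists_finset_forall_mem_iff (Q := fun _ j => Even j) fun _ _ => id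
  refine ⟨T, h.forall_adj (fun h => by tauto) fun i j hj => ?_, ?_, hT⟩
  · rw [hT hj.le, hT hj, Nat.even_add_one, not_not]
  · have hc : c ∈ T := h.zero (Classical.arbitrary ι) ▸ (hT (Nat.zero_le _)).2 Even.zero
    rw [h.card_eq, if_pos hc, add_comm]
    congr 1
    refine sum_congr rfl fun i _ => ?_
    rw [← Nat.Ioc_filter_dvd_card_eq_div]
    exact congrArg card (filter_congr fun j hj =>
      (hT (mem_Ioc.1 hj).2).trans even_iff_two_dvd)

lemma exists_odd_cover [Nonempty ι] (h : LegSystem F c m g) :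
    ∃ T : Finset V, IsIndependentCover F T ∧ #T = ∑ i, (m i + 1) / 2 ∧
      ∀ {i j}, j ≤ m i → (g i j ∈ T ↔ Odd j) := by
  classical
  obtain ⟨T, hT⟩ := h.exists_finset_forall_mem_iff (Q := fun _ j => Odd j) fun _ _ => id
  refine ⟨T, h.forall_adj (fun h => by tauto) fun i j hj => ?_, ?_, hT⟩
  · rw [hT hj.le, hT hj, Nat.odd_add_one, not_not]
  · have hc : c ∉ T := h.zero (Classical.arbitrary ι) ▸ fun hc =>
      Nat.not_odd_zero ((hT (Nat.zero_le _)).1 hc)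
    rw [h.card_eq, if_neg hc, zero_add]
    refine sum_congr rfl fun i _ => ?_
    rw [← card_filter_odd_Ioc]
    exact congrArg card (filter_congr fun j hj => hT (mem_Ioc.1 hj).2)

end Covers

section Splits

variable [Finite V] [Fintype ι]

lemma splits_even [Nonempty ι] (h : LegSystem F c m g) :
    Splits F (∑ i, m i / 2 + 1) (⊥ : SimpleGraph Empty) := by
  obtain ⟨T, hT, hcard, -⟩ := h.exists_even_cover
  exact hcard ▸ hT.splits_bot

lemma splits_odd [Nonempty ι] (h : LegSystem F c m g) :
    Splits F (∑ i, (m i + 1) / 2) (⊥ : SimpleGraph Empty) := by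
  obtain ⟨T, hT, hcard, -⟩ := h.exists_odd_cover
  exact hcard ▸ hT.splits_bot

lemma splits_pathGraph_even (h : LegSystem F c m g) {i₀ : ι} (hi₀ : 2 ≤ m i₀) :
    Splits F (∑ i, m i / 2) (SimpleGraph.pathGraph 3) := by
  classical
  have := Fintype.ofFinite V
  have : Nonempty ι := ⟨i₀⟩
  obtain ⟨T, hT, hcard, hmem⟩ := h.exists_even_cover
  simpa only [hcard, Nat.add_sub_cancel] using hT.splits_pathGraph ((hmem hi₀).2 even_two)
    (h.degree_le_two one_le_two hi₀) (h.three_le_card hi₀)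

lemma splits_pathGraph_odd (h : LegSystem F c m g) {i₀ : ι} (hi₀ : 2 ≤ m i₀) :
    Splits F (∑ i, (m i + 1) / 2 - 1) (SimpleGraph.pathGraph 3) := by
  classical
  have := Fintype.ofFinite V
  have : Nonempty ι := ⟨i₀⟩
  obtain ⟨T, hT, hcard, hmem⟩ := h.exists_odd_cover
  exact hcard ▸ hT.splits_pathGraph ((hmem (h.pos i₀)).2 odd_one)
    (h.degree_le_two le_rfl (h.pos i₀)) (h.three_le_card hi₀)

lemma splits_matchingGraph_even [Fintype κ] [Nonempty ι] (h : LegSystem F c m g) (I : κ ↪ ι)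
    (hI : ∀ a, Even (m (I a))) :
    Splits F (∑ i, m i / 2 + 1 - Fintype.card κ) (matchingGraph κ) := by
  obtain ⟨T, hT, hcard, hmem⟩ := h.exists_even_cover
  have hm {a} : 2 ≤ m (I a) := by
    have := h.pos (I a)
    have := hI a
    grind
  refine hcard ▸ hT.splits_matchingGraph (leaf := fun a => g (I a) (m (I a)))
    (nb := fun a => g (I a) (m (I a) - 1)) (h.injective_leaf.comp I.injective) ?_ ?_ ?_
    fun a w => h.eq_of_adj_leaf
  · intro a b hab
    have := hm (a := a)
    have := hm (a := b)
    exact I.injective (h.inj (by lia) (by lia) (by lia) (by lia) hab).1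
  · exact fun a => (hmem le_rfl).2 (hI a)
  · intro a ha
    have := hm (a := a)
    have := hI a
    grind

lemma splits_matchingGraph_odd [Nonempty ι] (h : LegSystem F c m g) (hm : ∀ i, Odd (m i))
    (hone : ∀ i i', m i = 1 → m i' = 1 → i = i') :
    Splits F (∑ i, m i / 2) (matchingGraph ι) := by
  obtain ⟨T, hT, hcard, hmem⟩ := h.exists_odd_cover
  have hsum : ∑ i, (m i + 1) / 2 - Fintype.card ι = ∑ i, m i / 2 := by
    rw [← card_univ, card_eq_sum_ones,
      Nat.sub_eq_iff_eq_add (sum_le_sum fun i _ => by grind [hm i]), ← sum_add_distrib]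
    exact sum_congr rfl fun i _ => by grind [hm i]
  rw [← hsum, ← hcard]
  refine hT.splits_matchingGraph (leaf := fun i => g i (m i)) (nb := fun i => g i (m i - 1))
    h.injective_leaf ?_ ?_ ?_ fun i w => h.eq_of_adj_leaf
  · intro i i' hii
    have := h.pos i
    have := h.pos i'
    obtain ⟨hlen, hzero | hi⟩ := h.eq_or_of_eq (Nat.sub_le _ _) (Nat.sub_le _ _) hii
    · exact hone i i' (by lia) (by lia)
    · exact hi
  · exact fun i => (hmem le_rfl).2 (hm i)
  · intro i hi
    have := h.pos i
    have := hm i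
    grind

lemma exists_finset_of_five_le [DecidableEq ι] (h : LegSystem F c m g) {i₀ : ι} (hi₀ : 5 ≤ m i₀)
    (hodd : Odd (m i₀)) :
    ∃ T : Finset V, #T ≤ ∑ i, m i / 2 ∧ ∀ {i j}, j ≤ m i →
      (g i j ∈ T ↔ if i = i₀ then j = 0 ∨ Odd j ∧ j ≠ 1 ∧ j ≠ m i₀ else Even j) := by
  classical
  obtain ⟨T, hT⟩ := h.exists_finset_forall_mem_iff
    (Q := fun i j => if i = i₀ then j = 0 ∨ Odd j ∧ j ≠ 1 ∧ j ≠ m i₀ else Even j)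
    (fun i i' _ => by split_ifs <;> simp)
  refine ⟨T, ?_, hT⟩
  have hle (i) (hi : i ≠ i₀) : #{j ∈ Ioc 0 (m i) | g i j ∈ T} = m i / 2 := by
    rw [← Nat.Ioc_filter_dvd_card_eq_div]
    exact congrArg card (filter_congr fun j hj => by
      rw [hT (mem_Ioc.1 hj).2, if_neg hi, even_iff_two_dvd])
  have hlt : #{j ∈ Ioc 0 (m i₀) | g i₀ j ∈ T} < m i₀ / 2 := by
    have hsub : {j ∈ Ioc 0 (m i₀) | g i₀ j ∈ T} ⊆
        ({j ∈ Ioc 0 (m i₀) | Odd j}.erase 1).erase (m i₀) := fun j hj => by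
      obtain ⟨hj, hjT⟩ := mem_filter.1 hj
      rw [hT (mem_Ioc.1 hj).2, if_pos rfl] at hjT
      grind
    have := card_le_card hsub
    rw [card_erase_of_mem (by grind), card_erase_of_mem (by grind), card_filter_odd_Ioc] at this
    lia
  have hsum : ∑ i, #{j ∈ Ioc 0 (m i) | g i j ∈ T} < ∑ i, m i / 2 :=
    sum_lt_sum (fun i _ => if hi : i = i₀ then hi ▸ hlt.le else (hle i hi).le)
      ⟨i₀, mem_univ i₀, hlt⟩
  rw [h.card_eq T]
  split_ifs <;> lia

/- After the center, the even vertices of the other legs and the odd vertices of leg `i₀` other than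
its ends are removed, the edges `{1, 2}` and `{m i₀ - 1, m i₀}` of leg `i₀` remain. -/
lemma splits_matchingGraph_two (h : LegSystem F c m g) {i₀ : ι} (hi₀ : 5 ≤ m i₀)
    (hodd : Odd (m i₀)) : Splits F (∑ i, m i / 2) (matchingGraph (Fin 2)) := by
  classical
  obtain ⟨T, hcard, hT⟩ := h.exists_finset_of_five_le hi₀ hodd
  let pos : Fin 2 × Bool → ℕ := fun a =>
    bif a.2 then ![1, m i₀] a.1 else ![2, m i₀ - 1] a.1
  have hpos : ∀ a, pos a ≤ m i₀ := by
    rintro ⟨a, _ | _⟩ <;> fin_cases a <;> simp [pos] <;> lia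
  have hinj : Function.Injective fun a => g i₀ (pos a) := by
    intro a b hab
    have := (h.eq_or_of_eq (hpos a) (hpos b) hab).1
    obtain ⟨a, _ | _⟩ := a <;> obtain ⟨b, _ | _⟩ := b <;> fin_cases a <;> fin_cases b <;>
      simp [pos] at this ⊢ <;> lia
  refine ⟨T, ⟨_, hinj⟩, hcard, fun u hu v hv huv => ?_, fun u v hu hv huv => ?_⟩
  · refine h.forall_adj (P := fun u v => u ∈ T → v ∉ T) (by tauto) (fun i j hj => ?_) u v huv hu hv
    rw [hT hj.le, hT hj]
    grind
  · refine h.forall_adj (P := fun u v => u ∉ T → v ∉ T → (SimpleGraph.map _ _).Adj u v)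
      (fun hP hv hu => (hP hu hv).symm) (fun i j hj hu hv => ?_) u v huv hu hv
    rw [hT hj.le] at hu
    rw [hT hj] at hv
    rw [SimpleGraph.map_adj]
    obtain rfl | hi := eq_or_ne i i₀
    · obtain rfl | rfl : j = 1 ∨ j = m i - 1 := by grind
      · exact ⟨(0, true), (0, false), ⟨rfl, by simp⟩, rfl, rfl⟩
      · exact ⟨(1, false), (1, true), ⟨rfl, by simp⟩, rfl,
          by simp [pos, Nat.sub_add_cancel (h.pos i)]⟩
    · grind

end Splits

end LegSystem

/-! ### Spiders not contained in `S_{n,k}^p` -/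

/- `T` collects the vertices placed among the `k` dominating ones, and the label of any other vertex
is the number of the pair of consecutive vertices in which it is placed. -/
lemma exists_labelling_of_isContained_graphS {V : Type*} [Finite V] {F : SimpleGraph V}
    {n k p : ℕ} (hF : F.IsContained (graphS n k p)) :
    ∃ (T : Finset V) (X : V → ℕ), #T ≤ k ∧ ∀ u ∉ T, ∀ v ∉ T, F.Adj u v →
      X u = X v ∧ X u < p ∧ ∀ w ∉ T, X w = X u → w = u ∨ w = v := by
  have := Fintype.ofFinite V
  obtain ⟨f⟩ := hF
  have hinj {u v} (huv : (f u : ℕ) = f v) : u = v := f.injective (Fin.ext huv)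
  refine ⟨univ.filter fun v => (f v : ℕ) < k, fun v => (f v - k) / 2, ?_, fun u hu v hv huv => ?_⟩
  · exact (card_le_card_of_injOn (t := range k) (fun v => (f v : ℕ))
      (fun v hv => by simpa using hv) fun u _ v _ => hinj).trans_eq (card_range k)
  · rw [mem_filter_univ, not_lt] at hu hv
    obtain ⟨a, ha, hfuv⟩ := (graphS_adj_iff hu hv).1 (f.toHom.map_adj huv)
    change ((f u : ℕ) = _ ∧ (f v : ℕ) = _) ∨ ((f v : ℕ) = _ ∧ (f u : ℕ) = _) at hfuv
    refine ⟨by lia, by lia, fun w hw hwu => ?_⟩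
    rw [mem_filter_univ, not_lt] at hw
    have hfw : (f w : ℕ) = f u ∨ (f w : ℕ) = f v := by lia
    exact hfw.imp hinj hinj

namespace LegSystem

variable {V ι : Type*} {F : SimpleGraph V} {c : V} {m : ι → ℕ} {g : ι → ℕ → V} {T : Finset V}

/-- The edge between the positions `j` and `j + 1` of leg `i` has no end in `T`. -/
def Uncovered (m : ι → ℕ) (g : ι → ℕ → V) (T : Finset V) (i : ι) (j : ℕ) : Prop :=
  j < m i ∧ g i j ∉ T ∧ g i (j + 1) ∉ T

lemma exists_labelling [Finite V] (h : LegSystem F c m g) {n k p : ℕ}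
    (hF : F.IsContained (graphS n k p)) :
    ∃ (T : Finset V) (X : V → ℕ), #T ≤ k ∧
      (∀ {i j}, Uncovered m g T i j → X (g i j) = X (g i (j + 1)) ∧ X (g i j) < p) ∧
      ∀ {i j i' j'}, Uncovered m g T i j → Uncovered m g T i' j' → X (g i j) = X (g i' j') →
        i = i' ∧ j = j' := by
  obtain ⟨T, X, hT, hX⟩ := exists_labelling_of_isContained_graphS hF
  have hlabel {i j} (hij : Uncovered m g T i j) := hX _ hij.2.1 _ hij.2.2 (h.adj hij.1)
  refine ⟨T, X, hT, fun hij => ⟨(hlabel hij).1, (hlabel hij).2.1⟩,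
    fun {i j i' j'} hij hij' hXX => ?_⟩
  have heq {i j i' j'} (hj : j ≤ m i) (hj' : j' ≤ m i') := h.eq_or_of_eq (j := j) (j' := j') hj hj'
  rcases (hlabel hij').2.2 _ hij.2.1 hXX with hu | hu <;>
    rcases (hlabel hij').2.2 _ hij.2.2 ((hlabel hij).1 ▸ hXX) with hv | hv
  · have := (heq hij.1.le hij'.1.le hu).1
    have := (heq hij.1 hij'.1.le hv).1
    lia
  · obtain ⟨hj, hi⟩ := heq hij.1 hij'.1 hv
    exact ⟨hi.resolve_left (by lia), by lia⟩
  · have := (heq hij.1.le hij'.1 hu).1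
    have := (heq hij.1 hij'.1.le hv).1
    lia
  · have := (heq hij.1.le hij'.1 hu).1
    have := (heq hij.1 hij'.1 hv).1
    lia

variable [Fintype ι]

/- The pairs consist of the positions `a i + 2 * s` and `a i + 2 * s + 1` on leg `i`; the condition
on `a` makes them disjoint, since legs only share the position `0`. -/
lemma sum_le_card_of_pairs (h : LegSystem F c m g) (a t : ι → ℕ)
    (ha : ∀ i i', a i = 0 → a i' = 0 → i = i') (hat : ∀ i, a i + 2 * t i ≤ m i + 1)
    (hT : ∀ i, ∀ s < t i, ¬ Uncovered m g T i (a i + 2 * s)) : ∑ i, t i ≤ #T := by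
  have hhit : ∀ x : Σ i, Fin (t i), ∃ d ≤ 1, g x.1 (a x.1 + 2 * x.2 + d) ∈ T := by
    rintro ⟨i, s, hs⟩
    have := hat i
    by_cases hmem : g i (a i + 2 * s) ∈ T
    · exact ⟨0, zero_le_one, hmem⟩
    · refine ⟨1, le_rfl, not_not.1 fun hmem' => hT i s hs ⟨by lia, hmem, hmem'⟩⟩
  choose d hd hdT using hhit
  have hinj : Function.Injective
      fun x => (⟨g x.1 (a x.1 + 2 * x.2 + d x), hdT x⟩ : T) := by
    rintro ⟨i, s⟩ ⟨i', s'⟩ he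
    have := hat i
    have := hat i'
    have := hd ⟨i, s⟩
    have := hd ⟨i', s'⟩
    obtain ⟨hpos, hi⟩ := h.eq_or_of_eq (by grind) (by grind) (congrArg Subtype.val he)
    obtain rfl : i = i' := hi.elim (fun hzero => ha i i' (by grind) (by grind)) id
    exact Sigma.ext rfl (heq_of_eq (Fin.ext (by grind)))
  simpa using Fintype.card_le_of_injective _ hinj

lemma exists_uncovered (h : LegSystem F c m g) {i₀ : ι} (hi₀ : Odd (m i₀))
    (hT : #T ≤ ∑ i, m i / 2)
    (hparity : ∀ i, (∀ j, Uncovered m g T i j → 1 ≤ j → Even j) ∨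
      Odd (m i) ∧ ∀ j, Uncovered m g T i j → 1 ≤ j → Odd j) :
    ∃ j, Uncovered m g T i₀ j := by
  classical
  by_contra! hcov
  have hstart : ∀ i, ∃ b, 1 ≤ b ∧ b + 2 * (m i / 2) ≤ m i + 1 ∧
      ∀ s, ¬ Uncovered m g T i (b + 2 * s) := by
    intro i
    rcases hparity i with heven | ⟨hm, hodd⟩
    · exact ⟨1, le_rfl, by lia, fun s hs => by grind [heven _ hs (by lia)]⟩
    · exact ⟨2, one_le_two, by grind, fun s hs => by grind [hodd _ hs (by lia)]⟩
  choose b hb hbm hbcov using hstart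
  have hsum := h.sum_le_card_of_pairs (T := T) (fun i => if i = i₀ then 0 else b i)
    (fun i => m i / 2 + if i = i₀ then 1 else 0) (by grind) (by grind) (by grind)
  rw [sum_add_distrib, sum_ite_eq' univ i₀, if_pos (mem_univ i₀)] at hsum
  lia

variable [Finite V] (n : ℕ)

lemma free_graphS_zero (h : LegSystem F c m g) {i₀ : ι} (hi₀ : Odd (m i₀)) :
    F.Free (graphS n (∑ i, m i / 2) 0) := by
  intro hF
  obtain ⟨T, X, hT, hX, -⟩ := h.exists_labelling hF
  obtain ⟨j, hj⟩ := h.exists_uncovered hi₀ hT fun i => Or.inl fun j hj =>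
    absurd (hX hj).2 (Nat.not_lt_zero _)
  exact absurd (hX hj).2 (Nat.not_lt_zero _)

lemma free_graphS_one_even (h : LegSystem F c m g) [Nonempty ι] (hm : ∀ i, Even (m i)) :
    F.Free (graphS n (∑ i, m i / 2 - 1) 1) := by
  classical
  intro hF
  obtain ⟨T, X, hT, hX, huniq⟩ := h.exists_labelling hF
  have heq {i j i' j'} (hij : Uncovered m g T i j) (hij' : Uncovered m g T i' j') :=
    huniq hij hij' (by have := (hX hij).2; have := (hX hij').2; lia)
  have hsum := h.sum_le_card_of_pairs (T := T)
    (fun i => if ∃ j, Odd j ∧ Uncovered m g T i j then 0 else 1) (fun i => m i / 2) ?_ ?_ ?_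
  · obtain ⟨i₀⟩ := ‹Nonempty ι›
    have := single_le_sum (f := fun i => m i / 2) (fun _ _ => Nat.zero_le _) (mem_univ i₀)
    have := h.pos i₀
    grind [hm i₀]
  · intro i i' hi hi'
    obtain ⟨⟨j, -, hj⟩, j', -, hj'⟩ : (∃ j, Odd j ∧ Uncovered m g T i j) ∧
        ∃ j, Odd j ∧ Uncovered m g T i' j := by grind
    exact (heq hj hj').1
  · intro i
    split_ifs <;> lia
  · intro i s _ hcov
    split_ifs at hcov with hodd
    · obtain ⟨j, hj, hij⟩ := hodd
      grind [(heq hij hcov).2]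
    · exact hodd ⟨_, by grind, hcov⟩

lemma free_graphS_one_odd (h : LegSystem F c m g) [Nontrivial ι] (hm : ∀ i, Odd (m i)) :
    F.Free (graphS n (∑ i, m i / 2) 1) := by
  intro hF
  obtain ⟨T, X, hT, hX, huniq⟩ := h.exists_labelling hF
  have heq {i j i' j'} (hij : Uncovered m g T i j) (hij' : Uncovered m g T i' j') :=
    huniq hij hij' (by have := (hX hij).2; have := (hX hij').2; lia)
  have hcov i : ∃ j, Uncovered m g T i j := by
    refine h.exists_uncovered (hm i) hT fun i => ?_
    by_cases hodd : ∃ j, Odd j ∧ Uncovered m g T i j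
    · obtain ⟨j, hj, hij⟩ := hodd
      exact Or.inr ⟨hm i, fun j' hij' _ => (heq hij hij').2 ▸ hj⟩
    · exact Or.inl fun j hij _ => Nat.not_odd_iff_even.1 fun hj => hodd ⟨j, hj, hij⟩
  obtain ⟨i, i', hne⟩ := exists_pair_ne ι
  exact hne (heq (hcov i).choose_spec (hcov i').choose_spec).1

lemma free_graphS_short (h : LegSystem F c m g) (hm : ∀ i, m i = 1 ∨ m i = 3) {p : ℕ}
    (hp : p < Fintype.card ι ∨ ∃ i i', i ≠ i' ∧ m i = 1 ∧ m i' = 1) :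
    F.Free (graphS n (∑ i, m i / 2) p) := by
  intro hF
  obtain ⟨T, X, hT, hX, huniq⟩ := h.exists_labelling hF
  have hsucc {i j} (hij : Uncovered m g T i j) (hij' : Uncovered m g T i (j + 1)) : False := by
    have := (huniq hij hij' (hX hij).1).2
    lia
  have hcov i : ∃ j, Uncovered m g T i j := by
    refine h.exists_uncovered (by grind [hm i]) hT fun i => ?_
    by_cases hone : Uncovered m g T i 1
    · refine Or.inr ⟨by grind [hm i], fun j hij hj => ?_⟩
      have : j ≠ 2 := by rintro rfl; exact hsucc hone hij
      have := hij.1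
      grind [hm i]
    · refine Or.inl fun j hij hj => ?_
      have : j ≠ 1 := by rintro rfl; exact hone hij
      have := hij.1
      grind [hm i]
  choose J hJ using hcov
  rcases hp with hp | ⟨i, i', hne, hi, hi'⟩
  · have hinj : Function.Injective fun i => (⟨X (g i (J i)), (hX (hJ i)).2⟩ : Fin p) :=
      fun i i' hii => (huniq (hJ i) (hJ i') (congrArg Fin.val hii)).1
    simpa using hp.trans_le (Fintype.card_le_of_injective _ hinj)
  · refine hne (huniq (hJ i) (hJ i') ?_).1
    have hzero {i} (hi : m i = 1) : g i (J i) = c := by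
      rw [Nat.lt_one_iff.1 ((hJ i).1.trans_eq hi), h.zero i]
    rw [hzero hi, hzero hi']

end LegSystem

/-! ### Extremal graphs of spiders -/

namespace LegSystem

variable {V ι : Type*} [Fintype ι] {F : SimpleGraph V} {c : V} {m : ι → ℕ} {g : ι → ℕ → V}

lemma card_odd (h : LegSystem F c m g) :
    #{i | Odd (m i)} = #{i | Odd (m i) ∧ 5 ≤ m i} + #{i | m i = 3} + #{i | m i = 1} := by
  simp only [card_filter, ← sum_add_distrib]
  exact sum_congr rfl fun i _ => by grind [h.pos i]

lemma card_vertices_eq_add_card_odd [Fintype V] (h : LegSystem F c m g) :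
    Fintype.card V = 1 + 2 * ∑ i, m i / 2 + #{i | Odd (m i)} := by
  rw [h.card_vertices_eq_one_add_sum, card_filter, mul_sum, add_assoc, ← sum_add_distrib]
  exact congrArg _ (sum_congr rfl fun i _ => by grind)

omit [Fintype ι] in
lemma eq_one_or_eq_three (h : LegSystem F c m g) (hm : ∀ i, Odd (m i))
    (h5 : ∀ i, ¬(Odd (m i) ∧ 5 ≤ m i)) (i : ι) : m i = 1 ∨ m i = 3 := by
  grind [h.pos i]

variable [Finite V]

lemma eventually_SPEX_eq (h : LegSystem F c m g) (hF : F.IsTree) {i₀ : ι} (hi₀ : 2 ≤ m i₀)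
    {p : ℕ → ℕ} (hmatch : ∀ n, (n - ∑ i, m i / 2) / 2 ≤ p n ∨
      Splits F (∑ i, m i / 2) (matchingGraph (Fin (p n + 1))))
    (hfree : ∀ n, F.Free (graphS n (∑ i, m i / 2) (p n))) :
    ∀ᶠ n in Filter.atTop, SPEX n F = isoClassS n (∑ i, m i / 2) (p n) := by
  have : Nonempty ι := ⟨i₀⟩
  have hpos := single_le_sum (f := fun i => m i / 2) (fun _ _ => Nat.zero_le _) (mem_univ i₀)
  have := Fintype.ofFinite V
  have hle := h.card_vertices_eq_add_card_odd
  exact eventually_SPEX_eq_isoClassS hF (by lia) (by lia) h.splits_even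
    (h.splits_pathGraph_even hi₀) hmatch hfree

lemma eventually_SPEX_eq_of_even_of_odd (h : LegSystem F c m g) (hF : F.IsTree) {i₀ i₁ : ι}
    (h₀ : Even (m i₀)) (h₁ : Odd (m i₁)) :
    ∀ᶠ n in Filter.atTop, SPEX n F = isoClassS n (∑ i, m i / 2) 0 := by
  have : Nonempty ι := ⟨i₀⟩
  refine h.eventually_SPEX_eq hF (i₀ := i₀) (by grind [h.pos i₀]) (fun _ => Or.inr ?_)
    fun n => h.free_graphS_zero n h₁
  simpa using h.splits_matchingGraph_even (κ := Fin 1)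
    ⟨fun _ => i₀, Function.injective_of_subsingleton _⟩ fun _ => h₀

lemma eventually_SPEX_eq_of_forall_even (h : LegSystem F c m g) (hF : F.IsTree) [Nontrivial ι]
    (hm : ∀ i, Even (m i)) :
    ∀ᶠ n in Filter.atTop, SPEX n F = isoClassS n (∑ i, m i / 2 - 1) 1 := by
  classical
  obtain ⟨i₀, i₁, hne⟩ := exists_pair_ne ι
  have hm2 i : 2 ≤ m i := by grind [h.pos i, hm i]
  have hsum : ∑ i, (m i + 1) / 2 = ∑ i, m i / 2 := sum_congr rfl fun i _ => by grind [hm i]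
  have htwo : 2 ≤ ∑ i, m i / 2 := by
    have hpair := sum_le_sum_of_subset (f := fun i => m i / 2) (subset_univ {i₀, i₁})
    rw [sum_pair hne] at hpair
    have := hm2 i₀
    have := hm2 i₁
    lia
  have := Fintype.ofFinite V
  have hle := h.card_vertices_eq_add_card_odd
  refine eventually_SPEX_eq_isoClassS hF (by lia) (by lia) ?_
    (hsum ▸ h.splits_pathGraph_odd (hm2 i₀)) (fun _ => Or.inr ?_)
    fun n => h.free_graphS_one_even n hm
  · rw [Nat.sub_add_cancel (by lia), ← hsum]
    exact h.splits_odd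
  · have hinj : Function.Injective ![i₀, i₁] := by simpa using hne
    simpa using h.splits_matchingGraph_even ⟨_, hinj⟩ fun _ => hm _

lemma eventually_SPEX_eq_of_forall_odd (h : LegSystem F c m g) (hF : F.IsTree) [Nontrivial ι]
    (hm : ∀ i, Odd (m i)) {i₀ : ι} (hi₀ : 5 ≤ m i₀) :
    ∀ᶠ n in Filter.atTop, SPEX n F = isoClassS n (∑ i, m i / 2) 1 :=
  h.eventually_SPEX_eq hF (i₀ := i₀) (by lia)
    (fun _ => Or.inr (h.splits_matchingGraph_two hi₀ (hm i₀)))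
    fun n => h.free_graphS_one_odd n hm

lemma eventually_SPEX_eq_of_short (h : LegSystem F c m g) (hF : F.IsTree)
    (hm : ∀ i, m i = 1 ∨ m i = 3) {i₀ : ι} (hi₀ : m i₀ = 3)
    (hone : #{i | m i = 1} ≤ 1) :
    ∀ᶠ n in Filter.atTop, SPEX n F = isoClassS n (∑ i, m i / 2) (Fintype.card ι - 1) := by
  have : Nonempty ι := ⟨i₀⟩
  have hcard : Fintype.card ι - 1 + 1 = Fintype.card ι := Nat.sub_add_cancel Fintype.card_pos
  refine h.eventually_SPEX_eq hF (i₀ := i₀) (by lia) (fun _ => Or.inr ?_)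
    fun n => h.free_graphS_short n hm (Or.inl (by lia))
  rw [hcard]
  simp only [card_le_one, mem_filter_univ] at hone
  exact (h.splits_matchingGraph_odd (by grind) fun i i' hi hi' =>
    hone i hi i' hi').matchingGraph_congr (Fintype.equivFin ι)

lemma eventually_SPEX_eq_of_short_of_two (h : LegSystem F c m g) (hF : F.IsTree)
    (hm : ∀ i, m i = 1 ∨ m i = 3) {i₀ : ι} (hi₀ : m i₀ = 3)
    (htwo : 1 < #{i | m i = 1}) :
    ∀ᶠ n in Filter.atTop,
      SPEX n F = isoClassS n (∑ i, m i / 2) ((n - ∑ i, m i / 2) / 2) := by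
  obtain ⟨i, i', hi, hi', hne⟩ := one_lt_card_iff.1 htwo
  exact h.eventually_SPEX_eq hF (i₀ := i₀) (by lia) (fun _ => Or.inl le_rfl) fun n =>
    h.free_graphS_short n hm
      (Or.inr ⟨i, i', hne, (mem_filter_univ i).1 hi, (mem_filter_univ i').1 hi'⟩)

end LegSystem

end SpectralSpider

open SpectralSpider Finset in
theorem theorem1p6 {V : Type*} [Fintype V] (F : SimpleGraph V) [DecidableRel F.Adj]
    (c : V) (r₁ r₂ r₃ r s ℓ : ℕ) (hr : r = r₁ + r₂ + r₃) (hℓ : 4 ≤ ℓ)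
    (hF : SpectralSpider.IsSpider F) (hcard : Fintype.card V = ℓ)
    (hc : SpectralSpider.IsCenter F c)
    (hr₁ : SpectralSpider.legCount F c (fun k => Odd k ∧ 5 ≤ k) = r₁)
    (hr₂ : SpectralSpider.legCount F c (fun k => k = 3) = r₂)
    (hr₃ : SpectralSpider.legCount F c (fun k => k = 1) = r₃)
    (hs : SpectralSpider.legCount F c (fun k => Even k) = s) :
    ∃ N : ℕ, ∀ n : ℕ, N ≤ n →
      (1 ≤ s → 1 ≤ r →
        SpectralSpider.SPEX n F = SpectralSpider.isoClassS n ((ℓ - r - 1) / 2) 0) ∧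
      (1 ≤ s → r = 0 →
        SpectralSpider.SPEX n F = SpectralSpider.isoClassS n ((ℓ - 3) / 2) 1) ∧
      (s = 0 → 1 ≤ r₁ →
        SpectralSpider.SPEX n F = SpectralSpider.isoClassS n ((ℓ - r - 1) / 2) 1) ∧
      (s = 0 → r₁ = 0 → 1 ≤ r₂ → (r₃ = 0 ∨ r₃ = 1) →
        SpectralSpider.SPEX n F = SpectralSpider.isoClassS n ((ℓ - r - 1) / 2) (r - 1)) ∧
      (s = 0 → r₁ = 0 → 1 ≤ r₂ → 2 ≤ r₃ →
        SpectralSpider.SPEX n F =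
          SpectralSpider.isoClassS n ((ℓ - r - 1) / 2) ((2 * n + r + 1 - ℓ) / 4)) := by
  obtain ⟨m, g, h, hlegs, hcount⟩ := exists_legSystem hF hc
  have := Fintype.one_lt_card_iff_nontrivial.1 hlegs
  rw [hcount] at hr₁ hr₂ hr₃ hs
  have hodd := h.card_odd
  rw [hr₁, hr₂, hr₃, ← hr] at hodd
  have hsize := h.card_vertices_eq_add_card_odd
  rw [hcard, hodd] at hsize
  have hk : (ℓ - r - 1) / 2 = ∑ i, m i / 2 := by lia
  rw [← Filter.eventually_atTop]
  simp only [Filter.eventually_and, Filter.eventually_imp_distrib_left, hk,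
    ← Nat.le_one_iff_eq_zero_or_eq_one]
  simp only [← hodd, ← hs, ← hr₁, ← hr₂, ← hr₃] at hsize ⊢
  simp only [card_eq_zero, one_le_card, filter_nonempty_iff, filter_eq_empty_iff, mem_univ,
    true_and, true_imp_iff, Nat.not_even_iff_odd, Nat.not_odd_iff_even]
  refine ⟨fun ⟨i₀, h₀⟩ ⟨i₁, h₁⟩ => h.eventually_SPEX_eq_of_even_of_odd hF.1 h₀ h₁,
    fun _ hm => ?_, fun hm ⟨i₀, _, h₀⟩ => h.eventually_SPEX_eq_of_forall_odd hF.1 hm h₀,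
    fun hm h5 ⟨i₀, h₀⟩ hone => ?_, fun hm h5 ⟨i₀, h₀⟩ htwo => ?_⟩
  · have hzero : #{i | Odd (m i)} = 0 := by simpa using hm
    rw [show (ℓ - 3) / 2 = ∑ i, m i / 2 - 1 by lia]
    exact h.eventually_SPEX_eq_of_forall_even hF.1 hm
  · rw [filter_true_of_mem fun i _ => @hm i]
    exact h.eventually_SPEX_eq_of_short hF.1 (h.eq_one_or_eq_three hm h5) h₀ hone
  · simp only [show ∀ n, (2 * n + #{i | Odd (m i)} + 1 - ℓ) / 4 = (n - ∑ i, m i / 2) / 2 by lia]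
    exact h.eventually_SPEX_eq_of_short_of_two hF.1 (h.eq_one_or_eq_three hm h5) h₀ htwo
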